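/- The ground field is $\mathbb{C}$. Let $V, V_*$ be vector spaces of countably infinite dimension with a non-degenerate bilinear pairing $\langle\cdot,\cdot\rangle: V\times V_*\to\mathbb{C}$. Let $\mathfrak{gl}(V,V_*)$ be the Lie algebra $V\otimes V_*$ with the commutator bracket of the associative product $(v_1\otimes w_1)(v_2\otimes w_2)=\langle v_2,w_1\rangle\, v_1\otimes w_2$, and let $\mathfrak{sl}(V,V_*)=[\mathfrak{gl}(V,V_*),\mathfrak{gl}(V,V_*)]$. They act on the natural module $V$ by $(v_1\otimes w_1)\cdot v_2=\langle v_2,w_1\rangle v_1$ and on the conatural module $V_*$ by $(v_2\otimes w_2)\cdot w_1=-\langle v_2,w_1\rangle w_2$. If $V_*=V$ and the form is antisymmetric (respectively symmetric), let $\mathfrak{sp}(V)=S^2(V)$ (respectively $\mathfrak{so}(V)=\bigwedge^2(V)$) be the corresponding Lie subalgebra of $\mathfrak{gl}(V,V)$; its natural and conatural modules are both $V$. Let $\mathfrak g$ be one of $\mathfrak{gl}(V,V_*)$, $\mathfrak{sl}(V,V_*)$, $\mathfrak{sp}(V)$, $\mathfrak{so}(V)$. A tensor $\mathfrak g$-module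 is a subquotient of a finite direct sum of copies of $\bigoplus_{p+q\le r}V^{\otimes p}\otimes V_*^{\otimes q}$ for some $r$ (with $q=0$ only, if $\mathfrak g=\mathfrak{sp}(V)$ or $\mathfrak{so}(V)$). For a module $M$ over a Lie algebra, $\operatorname{soc}M$ is the sum of all simple submodules, and the socle filtration is defined by $\operatorname{soc}^{(0)}M=0$ and $\operatorname{soc}^{(r+1)}M=\pi_r^{-1}(\operatorname{soc}(M/\operatorname{soc}^{(r)}M))$, where $\pi_r:M\to M/\operatorname{soc}^{(r)}M$ is the projection. If $\mathfrak g'$ is also one of these Lie algebras, with natural and conatural modules $V',V'_*$, then an embedding (injective homomorphism of Lie algebras) $\mathfrak g'\to\mathfrak g$ is of general tensor type if there are $k,l\in\mathbb{Z}_{\ge0}$, not both zero, such that $$\operatorname{soc}_{\mathfrak g'}V\cong kV'\oplus lV'_*\oplus N_a,\quad V/\operatorname{soc}_{\mathfrak g'}V\cong N_b,\quad \operatorname{soc}_{\mathfrak g'}V_*\cong lV'\oplus kV'_*\oplus N_c,\quad V_*/\operatorname{soc}_{\mathfrak g'}V_*\cong N_d$$ with trivial $\mathfrak g'$-modules $N_a,N_b,N_c,N_d$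 of at most countable dimension. Let $V',V'_*$ be another pair of vector spaces of countably infinite dimension with a non-degenerate pairing. (i) Let $\mathfrak g=\mathfrak{sl}(V,V_*)$. Every embedding $\varphi:\mathfrak{sl}(V',V'_*)\to\mathfrak g$ extends to an embedding $\psi:\mathfrak{gl}(V',V'_*)\to\mathfrak{gl}(V,V_*)$ of general tensor type such that the following holds for every tensor $\mathfrak g$-module $M$. The $\mathfrak g$-module structure of $M$ extends uniquely to a structure of a tensor $\mathfrak{gl}(V,V_*)$-module, and, with $M$ considered as a $\mathfrak{gl}(V',V'_*)$-module through this structure and $\psi$, one has $\operatorname{soc}^{(r)}_{\mathfrak{sl}(V',V'_*)}M=\operatorname{soc}^{(r)}_{\mathfrak{gl}(V',V'_*)}M$ for all $r$. (ii) Let $\mathfrak g$ be $\mathfrak{gl}(V,V_*)$, $\mathfrak{sp}(V)$ or $\mathfrak{so}(V)$. Every embedding $\varphi:\mathfrak{sl}(V',V'_*)\to\mathfrak g$ extends to an embedding $\psi:\mathfrak{gl}(V',V'_*)\to\mathfrak g$ of general tensor type such that $\operatorname{soc}^{(r)}_{\mathfrak{sl}(V',V'_*)}M=\operatorname{soc}^{(r)}_{\mathfrak{gl}(V',V'_*)}M$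 for every tensor $\mathfrak g$-module $M$ and all $r$. -/

import Mathlib

open scoped TensorProduct DirectSum

noncomputable section

namespace LocFin

/-! ### Restriction of modules, socle filtration -/

section Socle

universe u v w

/-- The restriction of an `L`-module `M` along a homomorphism `φ : L' → L` of Lie algebras:
the vector space `M`, on which `x : L'` acts as `φ x`. -/
def Res {L' : Type u} {L : Type v} [LieRing L'] [LieAlgebra ℂ L'] [LieRing L] [LieAlgebra ℂ L]
    (_φ : L' →ₗ⁅ℂ⁆ L) (M : Type w) : Type w := M

variable {L' : Type u} {L : Type v} [LieRing L'] [LieAlgebra ℂ L'] [LieRing L] [LieAlgebra ℂ L]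

instance (φ : L' →ₗ⁅ℂ⁆ L) (M : Type w) [h : AddCommGroup M] : AddCommGroup (Res φ M) := h

instance (φ : L' →ₗ⁅ℂ⁆ L) (M : Type w) [AddCommGroup M] [h : Module ℂ M] :
    Module ℂ (Res φ M) := h

instance (φ : L' →ₗ⁅ℂ⁆ L) (M : Type w) [AddCommGroup M] [LieRingModule L M] :
    LieRingModule L' (Res φ M) := LieRingModule.compLieHom M φ

instance (φ : L' →ₗ⁅ℂ⁆ L) (M : Type w) [AddCommGroup M] [Module ℂ M] [LieRingModule L M]
    [LieModule ℂ L M] : LieModule ℂ L' (Res φ M) := LieModule.compLieHom M φ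

theorem res_lie (φ : L' →ₗ⁅ℂ⁆ L) (M : Type w) [AddCommGroup M] [LieRingModule L M]
    (x : L') (m : M) : (⁅x, (m : Res φ M)⁆ : Res φ M) = (⁅φ x, m⁆ : M) := rfl

variable (L)

/-- The socle of a module: the sum of all its simple submodules. -/
def socle (M : Type w) [AddCommGroup M] [Module ℂ M] [LieRingModule L M] [LieModule ℂ L M] :
    LieSubmodule ℂ L M :=
  sSup {N : LieSubmodule ℂ L M | IsAtom N}

/-- The socle filtration: `soc^(0) M = 0`, and `soc^(r+1) M` is the preimage of
`soc (M / soc^(r) M)` under the projection `M → M / soc^(r) M`. -/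
def socFiltration (M : Type w) [AddCommGroup M] [Module ℂ M] [LieRingModule L M]
    [LieModule ℂ L M] : ℕ → LieSubmodule ℂ L M
  | 0 => ⊥
  | r + 1 => (socle L (M ⧸ socFiltration M r)).comap
      (LieSubmodule.Quotient.mk' (socFiltration M r))

variable {L}

/-- The term `soc^(r)_{L'} M` of the socle filtration over `L'` of an `L`-module `M`, where `L'`
acts through `φ : L' → L`, as a linear subspace of `M`. -/
def socAlong (φ : L' →ₗ⁅ℂ⁆ L) (M : Type w) [AddCommGroup M] [Module ℂ M] [LieRingModule L M]
    [LieModule ℂ L M] (r : ℕ) : Submodule ℂ M :=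
  (socFiltration L' (Res φ M) r).toSubmodule

end Socle

/-! ### Direct sums of two modules, tensor powers -/

section Constructions

universe u v w v₁ v₂

variable (L : Type u) [LieRing L] [LieAlgebra ℂ L]

/-- The direct sum of two modules. -/
instance prodLieRingModule (M : Type v) (N : Type w) [AddCommGroup M] [AddCommGroup N]
    [LieRingModule L M] [LieRingModule L N] : LieRingModule L (M × N) where
  bracket x m := (⁅x, m.1⁆, ⁅x, m.2⁆)
  add_lie x y m := Prod.ext (add_lie x y m.1) (add_lie x y m.2)
  lie_add x m n := Prod.ext (lie_add x m.1 n.1) (lie_add x m.2 n.2)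
  leibniz_lie x y m := Prod.ext (leibniz_lie x y m.1) (leibniz_lie x y m.2)

instance prodLieModule (M : Type v) (N : Type w) [AddCommGroup M] [AddCommGroup N]
    [Module ℂ M] [Module ℂ N] [LieRingModule L M] [LieRingModule L N]
    [LieModule ℂ L M] [LieModule ℂ L N] : LieModule ℂ L (M × N) where
  smul_lie c x m := Prod.ext (smul_lie c x m.1) (smul_lie c x m.2)
  lie_smul c x m := Prod.ext (lie_smul c x m.1) (lie_smul c x m.2)

/-- The tensor power `V^{⊗ p}`. -/
def TPow (V : Type v) [AddCommGroup V] [Module ℂ V] (p : ℕ) : Type v := ⨂[ℂ] _ : Fin p, V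

variable (V : Type v) [AddCommGroup V] [Module ℂ V]

instance (p : ℕ) : AddCommGroup (TPow V p) := inferInstanceAs (AddCommGroup (⨂[ℂ] _ : Fin p, V))

instance (p : ℕ) : Module ℂ (TPow V p) := inferInstanceAs (Module ℂ (⨂[ℂ] _ : Fin p, V))

variable {V}

/-- The operator `1 ⊗ ⋯ ⊗ A ⊗ ⋯ ⊗ 1`, with `A` in position `i`. -/
def actAt {p : ℕ} (i : Fin p) (A : Module.End ℂ V) :
    Module.End ℂ (⨂[ℂ] _ : Fin p, V) :=
  PiTensorProduct.map (Function.update (fun _ => (1 : Module.End ℂ V)) i A)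

theorem actAt_mul {p : ℕ} (i : Fin p) (A B : Module.End ℂ V) :
    actAt i (A * B) = actAt i A * actAt i B := by
  unfold actAt
  rw [← PiTensorProduct.map_mul]
  congr 1
  funext j
  by_cases h : j = i
  · subst h; simp
  · simp [h]

theorem actAt_comm {p : ℕ} {i j : Fin p} (hij : i ≠ j) (A B : Module.End ℂ V) :
    actAt i A * actAt j B = actAt j B * actAt i A := by
  unfold actAt
  rw [← PiTensorProduct.map_mul, ← PiTensorProduct.map_mul]
  congr 1
  funext k
  by_cases h : k = i
  · subst h; simp [hij]
  · by_cases h' : k = j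
    · subst h'; simp [h]
    · simp [h, h']

theorem actAt_add {p : ℕ} (i : Fin p) (A B : Module.End ℂ V) :
    actAt i (A + B) = actAt i A + actAt i B := by
  unfold actAt
  exact PiTensorProduct.map_update_add (s := fun _ : Fin p => V) (t := fun _ : Fin p => V)
    (fun _ => (1 : Module.End ℂ V)) i A B

theorem actAt_smul {p : ℕ} (i : Fin p) (c : ℂ) (A : Module.End ℂ V) :
    actAt i (c • A) = c • actAt i A := by
  unfold actAt
  exact PiTensorProduct.map_update_smul (s := fun _ : Fin p => V) (t := fun _ : Fin p => V)
    (fun _ => (1 : Module.End ℂ V)) i c A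

/-- The operator `∑ i, 1 ⊗ ⋯ ⊗ A ⊗ ⋯ ⊗ 1` on `V^{⊗ p}`, so that
`A (v₁ ⊗ ⋯ ⊗ v_p) = ∑ i, v₁ ⊗ ⋯ ⊗ A vᵢ ⊗ ⋯ ⊗ v_p`. -/
def tpowAct (p : ℕ) (A : Module.End ℂ V) : Module.End ℂ (TPow V p) :=
  (∑ i : Fin p, actAt i A : Module.End ℂ (⨂[ℂ] _ : Fin p, V))

theorem tpowAct_tprod (p : ℕ) (A : Module.End ℂ V) (v : Fin p → V) :
    tpowAct p A (PiTensorProduct.tprod ℂ v) =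
      (∑ i, PiTensorProduct.tprod ℂ (Function.update v i (A (v i))) : ⨂[ℂ] _ : Fin p, V) := by
  change (∑ i : Fin p, actAt i A : Module.End ℂ (⨂[ℂ] _ : Fin p, V))
    (PiTensorProduct.tprod ℂ v) = _
  rw [LinearMap.sum_apply]
  refine Finset.sum_congr rfl fun i _ => ?_
  unfold actAt
  rw [PiTensorProduct.map_tprod]
  congr 1
  funext j
  by_cases h : j = i
  · subst h; simp
  · simp [h]

theorem tpowAct_add (p : ℕ) (A B : Module.End ℂ V) :
    tpowAct p (A + B) = tpowAct p A + tpowAct p B := by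
  change (∑ i : Fin p, actAt i (A + B) : Module.End ℂ (⨂[ℂ] _ : Fin p, V)) =
    ∑ i : Fin p, actAt i A + ∑ i : Fin p, actAt i B
  rw [← Finset.sum_add_distrib]
  exact Finset.sum_congr rfl fun i _ => actAt_add i A B

theorem tpowAct_smul (p : ℕ) (c : ℂ) (A : Module.End ℂ V) :
    tpowAct p (c • A) = c • tpowAct p A := by
  change (∑ i : Fin p, actAt i (c • A) : Module.End ℂ (⨂[ℂ] _ : Fin p, V)) =
    c • ∑ i : Fin p, actAt i A
  rw [Finset.smul_sum]
  exact Finset.sum_congr rfl fun i _ => actAt_smul i c A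

theorem tpowAct_comm (p : ℕ) (A B : Module.End ℂ V) :
    tpowAct p (A * B - B * A) = tpowAct p A * tpowAct p B - tpowAct p B * tpowAct p A := by
  have hsub : tpowAct p (A * B - B * A) = tpowAct p (A * B) - tpowAct p (B * A) := by
    rw [eq_sub_iff_add_eq, ← tpowAct_add, sub_add_cancel]
  rw [hsub]
  change (∑ i : Fin p, actAt i (A * B) : Module.End ℂ (⨂[ℂ] _ : Fin p, V)) -
      ∑ i : Fin p, actAt i (B * A) =
    (∑ i : Fin p, actAt i A) * (∑ i : Fin p, actAt i B) -
      (∑ i : Fin p, actAt i B) * (∑ i : Fin p, actAt i A)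
  rw [Finset.sum_mul_sum, Finset.sum_mul_sum,
    Finset.sum_comm (f := fun i j => actAt i B * actAt j A),
    ← Finset.sum_sub_distrib, ← Finset.sum_sub_distrib]
  refine Finset.sum_congr rfl fun i _ => ?_
  rw [← Finset.sum_sub_distrib, Finset.sum_eq_single i]
  · rw [actAt_mul, actAt_mul]
  · intro j _ hj
    rw [actAt_comm hj.symm, sub_self]
  · intro h; exact absurd (Finset.mem_univ i) h

variable (V)
variable [LieRingModule L V] [LieModule ℂ L V]

/-- The usual action of a Lie algebra on a tensor power of a module, by derivations. -/
instance (p : ℕ) : LieRingModule L (TPow V p) where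
  bracket x t := tpowAct p (LieModule.toEnd ℂ L V x) t
  add_lie x y t := by
    rw [map_add, tpowAct_add, LinearMap.add_apply]
  lie_add x s t := map_add _ s t
  leibniz_lie x y t := by
    have h : LieModule.toEnd ℂ L V ⁅x, y⁆ = LieModule.toEnd ℂ L V x * LieModule.toEnd ℂ L V y -
        LieModule.toEnd ℂ L V y * LieModule.toEnd ℂ L V x := by
      ext v
      simp
    rw [h, tpowAct_comm, LinearMap.sub_apply, Module.End.mul_apply, Module.End.mul_apply,
      sub_add_cancel]

instance (p : ℕ) : LieModule ℂ L (TPow V p) where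
  smul_lie c x t := by
    change tpowAct p (LieModule.toEnd ℂ L V (c • x)) t = c • tpowAct p (LieModule.toEnd ℂ L V x) t
    rw [map_smul, tpowAct_smul, LinearMap.smul_apply]
  lie_smul c x t := map_smul (tpowAct p (LieModule.toEnd ℂ L V x)) c t

/-- The module `M` is a subquotient `N / K`, with `K ⊆ N ⊆ Y`, of a direct sum `Y` of finitely
many copies of `X`; equivalently, a homomorphic image of a submodule `N` of such a `Y`. -/
def IsSubquotientOfCopies (X : Type v) [AddCommGroup X] [Module ℂ X] [LieRingModule L X]
    [LieModule ℂ L X] (M : Type w) [AddCommGroup M] [Module ℂ M] [LieRingModule L M]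
    [LieModule ℂ L M] : Prop :=
  ∃ (m : ℕ) (N : LieSubmodule ℂ L (⨁ _ : Fin m, X)) (f : N →ₗ⁅ℂ,L⁆ M), Function.Surjective f

/-- `M` is a subquotient of a finite direct sum of copies of `⨁_{p + q ≤ r} V^{⊗ p} ⊗ V_*^{⊗ q}`
for some `r`. -/
def IsMixedTensorModule (V : Type v₁) [AddCommGroup V] [Module ℂ V] [LieRingModule L V]
    [LieModule ℂ L V] (Vs : Type v₂) [AddCommGroup Vs] [Module ℂ Vs] [LieRingModule L Vs]
    [LieModule ℂ L Vs] (M : Type w) [AddCommGroup M] [Module ℂ M] [LieRingModule L M]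
    [LieModule ℂ L M] : Prop :=
  ∃ r : ℕ, IsSubquotientOfCopies L
    (⨁ i : {i : ℕ × ℕ // i.1 + i.2 ≤ r}, (TPow V i.1.1 ⊗[ℂ] TPow Vs i.1.2)) M

/-- `M` is a subquotient of a finite direct sum of copies of `⨁_{p ≤ r} V^{⊗ p}` for some `r`. -/
def IsPureTensorModule (V : Type v₁) [AddCommGroup V] [Module ℂ V] [LieRingModule L V]
    [LieModule ℂ L V] (M : Type w) [AddCommGroup M] [Module ℂ M] [LieRingModule L M]
    [LieModule ℂ L M] : Prop :=
  ∃ r : ℕ, IsSubquotientOfCopies L (⨁ p : {p : ℕ // p ≤ r}, TPow V p.1) M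

end Constructions

/-! ### General tensor type -/

section TensorType

universe u v w₁ w₂ w₃ w₄

/-- One half of the condition of being of general tensor type, for an `L'`-module `V`:
`soc V ≅ k X ⊕ l Y ⊕ N_a` and `V / soc V ≅ N_b` with trivial modules `N_a`, `N_b` of at most
countable dimension.  (A module isomorphic to the summand `N_a` may be taken inside `V`.) -/
def HasTensorSocle (L' : Type u) [LieRing L'] [LieAlgebra ℂ L']
    (V : Type v) [AddCommGroup V] [Module ℂ V] [LieRingModule L' V] [LieModule ℂ L' V]
    (X : Type w₁) [AddCommGroup X] [Module ℂ X] [LieRingModule L' X] [LieModule ℂ L' X]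
    (Y : Type w₂) [AddCommGroup Y] [Module ℂ Y] [LieRingModule L' Y] [LieModule ℂ L' Y]
    (k l : ℕ) : Prop :=
  (∃ Na : LieSubmodule ℂ L' V, LieModule.IsTrivial L' Na ∧
    Module.rank ℂ Na ≤ Cardinal.aleph0 ∧
    Nonempty (socle L' V ≃ₗ⁅ℂ,L'⁆ ((⨁ _ : Fin k, X) × (⨁ _ : Fin l, Y) × Na))) ∧
  LieModule.IsTrivial L' (V ⧸ socle L' V) ∧ Module.rank ℂ (V ⧸ socle L' V) ≤ Cardinal.aleph0

/-- A homomorphism `φ : L' → L` is of general tensor type with respect to natural and conatural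
modules `V`, `V_*` of `L` and `V'`, `V'_*` of `L'` if, as modules over `L'`,
`soc V ≅ k V' ⊕ l V'_* ⊕ N_a`, `V / soc V ≅ N_b`,
`soc V_* ≅ l V' ⊕ k V'_* ⊕ N_c`, `V_* / soc V_* ≅ N_d`,
with `k`, `l` not both zero and `N_a`, `N_b`, `N_c`, `N_d` trivial. -/
def IsGeneralTensorType {L' : Type u} {L : Type v} [LieRing L'] [LieAlgebra ℂ L']
    [LieRing L] [LieAlgebra ℂ L] (φ : L' →ₗ⁅ℂ⁆ L)
    (V : Type w₁) [AddCommGroup V] [Module ℂ V] [LieRingModule L V] [LieModule ℂ L V]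
    (Vs : Type w₂) [AddCommGroup Vs] [Module ℂ Vs] [LieRingModule L Vs] [LieModule ℂ L Vs]
    (V' : Type w₃) [AddCommGroup V'] [Module ℂ V'] [LieRingModule L' V'] [LieModule ℂ L' V']
    (Vs' : Type w₄) [AddCommGroup Vs'] [Module ℂ Vs'] [LieRingModule L' Vs']
    [LieModule ℂ L' Vs'] : Prop :=
  ∃ k l : ℕ, (0 < k ∨ 0 < l) ∧
    HasTensorSocle L' (Res φ V) V' Vs' k l ∧ HasTensorSocle L' (Res φ Vs) V' Vs' l k

end TensorType

/-! ### The classical locally finite Lie algebras -/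

section Classical

universe u v

variable {V : Type u} [AddCommGroup V] [Module ℂ V] {Vs : Type v} [AddCommGroup Vs] [Module ℂ Vs]

/-- The space `V ⊗ V_*` underlying `gl(V, V_*)`, for a pairing `p` of `V` and `V_*`. -/
def Gl (_p : V →ₗ[ℂ] Vs →ₗ[ℂ] ℂ) : Type (max u v) := V ⊗[ℂ] Vs

/-- The natural module `V` of `gl(V, V_*)`. -/
def Natl (_p : V →ₗ[ℂ] Vs →ₗ[ℂ] ℂ) : Type u := V

/-- The conatural module `V_*` of `gl(V, V_*)`. -/
def Conatl (_p : V →ₗ[ℂ] Vs →ₗ[ℂ] ℂ) : Type v := Vs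

variable (p : V →ₗ[ℂ] Vs →ₗ[ℂ] ℂ)

instance : AddCommGroup (Gl p) := inferInstanceAs (AddCommGroup (V ⊗[ℂ] Vs))
instance : Module ℂ (Gl p) := inferInstanceAs (Module ℂ (V ⊗[ℂ] Vs))
instance : AddCommGroup (Natl p) := inferInstanceAs (AddCommGroup V)
instance : Module ℂ (Natl p) := inferInstanceAs (Module ℂ V)
instance : AddCommGroup (Conatl p) := inferInstanceAs (AddCommGroup Vs)
instance : Module ℂ (Conatl p) := inferInstanceAs (Module ℂ Vs)

/-- The element `v ⊗ w` of `gl(V, V_*)`. -/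
def tmul (v : V) (w : Vs) : Gl p := (v ⊗ₜ[ℂ] w : V ⊗[ℂ] Vs)

/-- The rank one operator `v₂ ↦ ⟨v₂, w₁⟩ v₁` on `V`, extended linearly to `v₁ ⊗ w₁ ∈ V ⊗ V_*`. -/
def natAct₀ : V ⊗[ℂ] Vs →ₗ[ℂ] Module.End ℂ V :=
  TensorProduct.lift (LinearMap.mk₂ ℂ (fun v w => (p.flip w).smulRight v)
    (by intros; ext; simp)
    (fun c m n => LinearMap.ext fun x => smul_comm _ c _)
    (by intros; ext; simp [add_smul]) (by intros; ext; simp [mul_smul]))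

/-- The operator `w₁ ↦ - ⟨v₂, w₁⟩ w₂` on `V_*`, extended linearly to `v₂ ⊗ w₂ ∈ V ⊗ V_*`. -/
def conatAct₀ : V ⊗[ℂ] Vs →ₗ[ℂ] Module.End ℂ Vs :=
  -TensorProduct.lift (LinearMap.mk₂ ℂ (fun v w => (p v).smulRight w)
    (by intros; ext; simp [add_smul]) (by intros; ext; simp [mul_smul])
    (by intros; ext; simp)
    (fun c m n => LinearMap.ext fun x => smul_comm _ c _))

theorem natAct₀_tmul (v x : V) (w : Vs) : natAct₀ p (v ⊗ₜ w) x = p x w • v := by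
  simp [natAct₀]

theorem conatAct₀_tmul (v : V) (w y : Vs) : conatAct₀ p (v ⊗ₜ w) y = -(p v y • w) := by
  simp [conatAct₀]

/-- The associative product on `V ⊗ V_*`, characterized by `glMul_tmul` below. -/
def glMul : Gl p →ₗ[ℂ] Module.End ℂ (Gl p) := LinearMap.rTensorHom Vs ∘ₗ natAct₀ p

/-- The action of `V ⊗ V_*` on `V`, characterized by `natAct_tmul` below. -/
def natAct : Gl p →ₗ[ℂ] Module.End ℂ (Natl p) := natAct₀ p

/-- The action of `V ⊗ V_*` on `V_*`, characterized by `conatAct_tmul` below. -/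
def conatAct : Gl p →ₗ[ℂ] Module.End ℂ (Conatl p) := conatAct₀ p

theorem natAct_tmul (v : V) (x : V) (w : Vs) :
    natAct p (tmul p v w) (x : Natl p) = (p x w • v : V) := natAct₀_tmul p v x w

theorem conatAct_tmul (v : V) (w y : Vs) :
    conatAct p (tmul p v w) (y : Conatl p) = (-(p v y • w) : Vs) := conatAct₀_tmul p v w y

theorem glMul_tmul (v₁ v₂ : V) (w₁ w₂ : Vs) :
    glMul p (tmul p v₁ w₁) (tmul p v₂ w₂) = p v₂ w₁ • tmul p v₁ w₂ := by
  change (natAct₀ p (v₁ ⊗ₜ w₁)).rTensor Vs (v₂ ⊗ₜ w₂) = p v₂ w₁ • (v₁ ⊗ₜ[ℂ] w₂ : V ⊗[ℂ] Vs)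
  rw [LinearMap.rTensor_tmul, natAct₀_tmul, TensorProduct.smul_tmul']

theorem gl_induction {P : Gl p → Prop} (a : Gl p) (zero : P 0)
    (tmul : ∀ v w, P (tmul p v w)) (add : ∀ a b, P a → P b → P (a + b)) : P a :=
  TensorProduct.induction_on (motive := P) a zero tmul add

theorem natAct_glMul (a b : Gl p) : natAct p (glMul p a b) = natAct p a * natAct p b := by
  induction a using gl_induction with
  | zero => simp
  | add a a' ha ha' => simp only [map_add, LinearMap.add_apply, ha, ha', add_mul]
  | tmul v w =>
    induction b using gl_induction with
    | zero => simp
    | add b b' hb hb' => simp only [map_add, hb, hb', mul_add]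
    | tmul v' w' =>
      rw [glMul_tmul, map_smul]
      refine LinearMap.ext fun (x : V) => ?_
      change (p v' w • natAct₀ p (v ⊗ₜ w') x : V) =
        natAct₀ p (v ⊗ₜ w) (natAct₀ p (v' ⊗ₜ w') x)
      rw [natAct₀_tmul, natAct₀_tmul, natAct₀_tmul, map_smul, LinearMap.smul_apply, smul_smul,
        smul_eq_mul, mul_comm, mul_smul]

theorem conatAct_glMul (a b : Gl p) :
    conatAct p (glMul p a b) = -(conatAct p b * conatAct p a) := by
  induction a using gl_induction with
  | zero => simp
  | add a a' ha ha' =>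
    simp only [map_add, LinearMap.add_apply, ha, ha', mul_add, neg_add]
  | tmul v w =>
    induction b using gl_induction with
    | zero => simp
    | add b b' hb hb' => simp only [map_add, hb, hb', add_mul, neg_add]
    | tmul v' w' =>
      rw [glMul_tmul, map_smul]
      refine LinearMap.ext fun (x : Vs) => ?_
      change (p v' w • conatAct₀ p (v ⊗ₜ w') x : Vs) =
        -conatAct₀ p (v' ⊗ₜ w') (conatAct₀ p (v ⊗ₜ w) x)
      rw [conatAct₀_tmul, conatAct₀_tmul, conatAct₀_tmul, map_neg, map_smul, smul_neg, neg_smul,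
        smul_smul, smul_eq_mul, neg_neg, mul_comm]

theorem glMul_assoc (a b c : Gl p) :
    glMul p (glMul p a b) c = glMul p a (glMul p b c) := by
  have h : natAct₀ p (glMul p a b) = natAct₀ p a * natAct₀ p b := natAct_glMul p a b
  change (natAct₀ p (glMul p a b)).rTensor Vs c =
    (natAct₀ p a).rTensor Vs ((natAct₀ p b).rTensor Vs c)
  rw [h, Module.End.mul_eq_comp, LinearMap.rTensor_comp]
  rfl

/-- The Lie algebra `gl(V, V_*)`: the space `V ⊗ V_*` with the commutator bracket `ab - ba` of the
associative product `(v₁ ⊗ w₁)(v₂ ⊗ w₂) = ⟨v₂, w₁⟩ v₁ ⊗ w₂`. -/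
instance : LieRing (Gl p) where
  bracket a b := glMul p a b - glMul p b a
  add_lie a b c := by
    change glMul p (a + b) c - glMul p c (a + b) =
      (glMul p a c - glMul p c a) + (glMul p b c - glMul p c b)
    rw [map_add, map_add, LinearMap.add_apply]; abel
  lie_add a b c := by
    change glMul p a (b + c) - glMul p (b + c) a =
      (glMul p a b - glMul p b a) + (glMul p a c - glMul p c a)
    rw [map_add, map_add, LinearMap.add_apply]; abel
  lie_self a := sub_self (glMul p a a)
  leibniz_lie a b c := by
    change glMul p a (glMul p b c - glMul p c b) - glMul p (glMul p b c - glMul p c b) a =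
      (glMul p (glMul p a b - glMul p b a) c - glMul p c (glMul p a b - glMul p b a)) +
      (glMul p b (glMul p a c - glMul p c a) - glMul p (glMul p a c - glMul p c a) b)
    simp only [map_sub, LinearMap.sub_apply, glMul_assoc]
    abel

theorem gl_lie_def (a b : Gl p) : ⁅a, b⁆ = glMul p a b - glMul p b a := rfl

instance : LieAlgebra ℂ (Gl p) where
  lie_smul t a b := by
    rw [gl_lie_def, gl_lie_def, map_smul, map_smul, LinearMap.smul_apply, smul_sub]

theorem tmul_lie_tmul (v₁ v₂ : V) (w₁ w₂ : Vs) :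
    ⁅tmul p v₁ w₁, tmul p v₂ w₂⁆ = p v₂ w₁ • tmul p v₁ w₂ - p v₁ w₂ • tmul p v₂ w₁ := by
  rw [gl_lie_def, glMul_tmul, glMul_tmul]

instance : LieRingModule (Gl p) (Natl p) where
  bracket a x := natAct p a x
  add_lie a b x := by rw [map_add, LinearMap.add_apply]
  lie_add a x y := map_add (natAct p a) x y
  leibniz_lie a b x := by
    rw [gl_lie_def, map_sub, natAct_glMul, natAct_glMul]
    simp

instance : LieModule ℂ (Gl p) (Natl p) where
  smul_lie c a x := by
    change natAct p (c • a) x = c • natAct p a x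
    rw [map_smul, LinearMap.smul_apply]
  lie_smul c a x := map_smul (natAct p a) c x

instance : LieRingModule (Gl p) (Conatl p) where
  bracket a x := conatAct p a x
  add_lie a b x := by rw [map_add, LinearMap.add_apply]
  lie_add a x y := map_add (conatAct p a) x y
  leibniz_lie a b x := by
    rw [gl_lie_def, map_sub, conatAct_glMul, conatAct_glMul]
    simp

instance : LieModule ℂ (Gl p) (Conatl p) where
  smul_lie c a x := by
    change conatAct p (c • a) x = c • conatAct p a x
    rw [map_smul, LinearMap.smul_apply]
  lie_smul c a x := map_smul (conatAct p a) c x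

theorem tmul_lie_nat (v x : V) (w : Vs) :
    (⁅tmul p v w, (x : Natl p)⁆ : Natl p) = (p x w • v : V) := natAct_tmul p v x w

theorem tmul_lie_conat (v : V) (w y : Vs) :
    (⁅tmul p v w, (y : Conatl p)⁆ : Conatl p) = (-(p v y • w) : Vs) := conatAct_tmul p v w y

/-- `sl(V, V_*) = [gl(V, V_*), gl(V, V_*)]`. -/
def Sl : LieSubalgebra ℂ (Gl p) :=
  (⁅(⊤ : LieIdeal ℂ (Gl p)), (⊤ : LieIdeal ℂ (Gl p))⁆ : LieIdeal ℂ (Gl p)).toLieSubalgebra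

theorem span_lie_mem {L : Type u} [LieRing L] [LieAlgebra ℂ L] {s : Set L}
    (h : ∀ x ∈ s, ∀ y ∈ s, ⁅x, y⁆ ∈ Submodule.span ℂ s) {x y : L}
    (hx : x ∈ Submodule.span ℂ s) (hy : y ∈ Submodule.span ℂ s) :
    ⁅x, y⁆ ∈ Submodule.span ℂ s := by
  induction hx using Submodule.span_induction with
  | zero => simp
  | add a b _ _ ha hb => rw [add_lie]; exact add_mem ha hb
  | smul c a _ ha => rw [smul_lie]; exact Submodule.smul_mem _ _ ha
  | mem a ha =>
    induction hy using Submodule.span_induction with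
    | zero => simp
    | add b c _ _ hb hc => rw [lie_add]; exact add_mem hb hc
    | smul c b _ hb => rw [lie_smul]; exact Submodule.smul_mem _ _ hb
    | mem b hb => exact h a ha b hb

variable (ω : V →ₗ[ℂ] V →ₗ[ℂ] ℂ)

/-- `sp(V) = S²(V) ⊆ V ⊗ V = gl(V, V)`, for an antisymmetric form on `V`. -/
def Sp (h : ∀ x y, ω x y = -ω y x) : LieSubalgebra ℂ (Gl ω) where
  __ := Submodule.span ℂ {a : Gl ω | ∃ v w : V, a = tmul ω v w + tmul ω w v}
  lie_mem' := by
    refine fun {_ _} hx hy => span_lie_mem ?_ hx hy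
    rintro _ ⟨v, w, rfl⟩ _ ⟨x, y, rfl⟩
    have key : ⁅tmul ω v w + tmul ω w v, tmul ω x y + tmul ω y x⁆ =
        ω x w • (tmul ω v y + tmul ω y v) + ω y w • (tmul ω v x + tmul ω x v) +
        ω x v • (tmul ω w y + tmul ω y w) + ω y v • (tmul ω w x + tmul ω x w) := by
      simp only [add_lie, lie_add, tmul_lie_tmul]
      rw [h v x, h v y, h w x, h w y]
      module
    rw [key]
    exact add_mem (add_mem (add_mem
      (Submodule.smul_mem _ _ (Submodule.subset_span ⟨_, _, rfl⟩))
      (Submodule.smul_mem _ _ (Submodule.subset_span ⟨_, _, rfl⟩)))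
      (Submodule.smul_mem _ _ (Submodule.subset_span ⟨_, _, rfl⟩)))
      (Submodule.smul_mem _ _ (Submodule.subset_span ⟨_, _, rfl⟩))

/-- `so(V) = ⋀²(V) ⊆ V ⊗ V = gl(V, V)`, for a symmetric form on `V`. -/
def So (h : ∀ x y, ω x y = ω y x) : LieSubalgebra ℂ (Gl ω) where
  __ := Submodule.span ℂ {a : Gl ω | ∃ v w : V, a = tmul ω v w - tmul ω w v}
  lie_mem' := by
    refine fun {_ _} hx hy => span_lie_mem ?_ hx hy
    rintro _ ⟨v, w, rfl⟩ _ ⟨x, y, rfl⟩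
    have key : ⁅tmul ω v w - tmul ω w v, tmul ω x y - tmul ω y x⁆ =
        ω x w • (tmul ω v y - tmul ω y v) - ω y w • (tmul ω v x - tmul ω x v) -
        ω x v • (tmul ω w y - tmul ω y w) + ω y v • (tmul ω w x - tmul ω x w) := by
      simp only [sub_lie, lie_sub, tmul_lie_tmul]
      rw [h v x, h v y, h w x, h w y]
      module
    rw [key]
    exact add_mem (sub_mem (sub_mem
      (Submodule.smul_mem _ _ (Submodule.subset_span ⟨_, _, rfl⟩))
      (Submodule.smul_mem _ _ (Submodule.subset_span ⟨_, _, rfl⟩)))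
      (Submodule.smul_mem _ _ (Submodule.subset_span ⟨_, _, rfl⟩)))
      (Submodule.smul_mem _ _ (Submodule.subset_span ⟨_, _, rfl⟩))

/-- A non-degenerate pairing of two vector spaces of countably infinite dimension. -/
structure IsCountablePairing : Prop where
  nondegenerate : p.Nondegenerate
  rank_left : Module.rank ℂ V = Cardinal.aleph0
  rank_right : Module.rank ℂ Vs = Cardinal.aleph0

end Classical

end LocFin

end

open LocFin

attribute [local instance 100] LieRing.ofAssociativeRing

/-! Countable dimension gives dual bases of V' and V'_* (`exists_dual_bases`), hence matrix units
e_ij in gl(V', V'_*). Under an embedding of sl(V', V'_*) the off-diagonal units become operators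
E_ij of finite rank on V. If e_ij and e_kl are orthogonal, then not only the commutator but the
product E_ij E_kl vanishes: e_ij is the central element of an infinite Heisenberg algebra commuting
with e_kl, this algebra acts on the finite-dimensional range of E_kl, and there its central element
must act by zero (`mul_eq_zero_of_heisenberg`).

These relations separate a natural from a conatural part. For i ≠ j the product E_ik E_kj keeps the
natural part of E_ij, and E_kj E_ik gives the conatural part. The two families are systems of matrix
units annihilating each other, so φ = α - β on sl, with α a homomorphism and β an antihomomorphism
of associative algebras defined on all of gl(V', V'_*) (`exists_split`). Then ψ = α - β is the
extension; it is injective because its kernel is central and gl has trivial center.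

If ⟨c, d⟩ = 1, then α(c ⊗ d) and β(c ⊗ d) are idempotents of finite ranks k and l on V. The images
of α and β supply k copies of V' and l copies of V'_*, and these contain everything of the form x ·
v, so a simple submodule is trivial or lies inside them (`IsSplitPair.hasTensorSocle`). On V_* the
roles of α and β are exchanged, and adjoint operators have equal rank.

For the socle filtrations, a vector m of a tensor module involves only finitely many vectors of V
and V_*. These are annihilated by α(a ⊗ b) and β(a ⊗ b) for a and b in subspaces of finite
codimension, which are never orthogonal; so m is annihilated by some t of trace one
(`IsSplitPair.exists_glTrace_eq_one`). Since x and x - tr(x) t act alike on m, sl and gl have the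
same orbits and the same submodules, and the socle filtration depends only on the lattice of
submodules (`socFiltration_succ`). The same device on gl(V, V_*) itself extends tensor sl-modules to
gl uniquely. Finally, sp and so are the -1 eigenspaces of the adjoint anti-involution, which
exchanges α and β and therefore negates α - β. -/

namespace LocFin

open scoped TensorProduct DirectSum

set_option linter.unusedSectionVars false

/-! ### Matrix units from commutator relations -/

section MatrixUnits

variable {R ι : Type*} [NonUnitalRing R]

/-- The relations between the images `E i j` (`i ≠ j`) of the elementary matrices under a
homomorphism of Lie algebras, when images of orthogonal elementary matrices multiply to zero. -/
structure IsElementary (E : ι → ι → R) : Prop where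
  mul_eq_zero : ∀ i j k l, i ≠ j → k ≠ l → i ≠ l → k ≠ j → E i j * E k l = 0
  comm : ∀ i j l, i ≠ j → j ≠ l → i ≠ l → E i j * E j l - E j l * E i j = E i l

/-- The negative transpose of a family indexed by pairs. -/
def negTranspose (E : ι → ι → R) (i j : ι) : R := -E j i

/-- This symmetry exchanges the natural and the conatural part, so that each statement about one
family of matrix units also serves for the other. -/
theorem IsElementary.negTranspose {E : ι → ι → R} (h : IsElementary E) :
    IsElementary (negTranspose E) where
  mul_eq_zero i j k l hij hkl hil hkj := by
    simp [LocFin.negTranspose, h.mul_eq_zero j i l k hij.symm hkl.symm hkj.symm hil.symm]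
  comm i j l hij hjl hil := by
    simp only [LocFin.negTranspose, neg_mul_neg]
    rw [← h.comm l j i hjl.symm hij.symm hil.symm, neg_sub]

theorem exists_fresh [Infinite ι] (s : Finset ι) : ∃ k, k ∉ s := Infinite.exists_notMem_finset s

open Classical in
theorem exists_ne_ne [Infinite ι] (i j : ι) : ∃ k, k ≠ i ∧ k ≠ j := by
  obtain ⟨k, hk⟩ := exists_fresh {i, j}
  exact ⟨k, by simpa using hk⟩

/-- The product `E i k * E k j` for some `k ≠ i, j`. -/
noncomputable def offUnit [Infinite ι] (E : ι → ι → R) (i j : ι) : R :=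
  E i (exists_ne_ne i j).choose * E (exists_ne_ne i j).choose j

/-- The matrix unit at `(i, j)`: for `k ≠ i, j`, the product of the off-diagonal units at
`(i, k)` and `(k, j)`. -/
noncomputable def matUnit [Infinite ι] (E : ι → ι → R) (i j : ι) : R :=
  offUnit E i (exists_ne_ne i j).choose * offUnit E (exists_ne_ne i j).choose j

namespace IsElementary

variable {E : ι → ι → R}

/-- Expand E i k as the commutator of E i k' and E k' k, and then commute E k' k past E k j; every
discarded term contains the vanishing product E i k' * E k j. -/
theorem mul_indep (h : IsElementary E) {i j k k' : ι} (hij : i ≠ j) (hki : k ≠ i) (hkj : k ≠ j) (hki' : k' ≠ i)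
    (hkj' : k' ≠ j) : E i k * E k j = E i k' * E k' j := by
  by_cases hk : k = k'
  · rw [hk]
  have h1 := h.comm i k' k hki'.symm (Ne.symm hk) hki.symm
  have h2 := h.comm k' k j (Ne.symm hk) hkj hkj'
  have h3 := h.mul_eq_zero i k' k j hki'.symm hkj hij hk
  rw [← h1, sub_mul, mul_assoc, mul_assoc, h3, mul_zero, sub_zero, sub_eq_iff_eq_add.1 h2, mul_add,
    ← mul_assoc (E i k'), h3, zero_mul, add_zero]

theorem offUnit_eq [Infinite ι] (h : IsElementary E) {i j k : ι} (hij : i ≠ j) (hki : k ≠ i) (hkj : k ≠ j) :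
    offUnit E i j = E i k * E k j :=
  h.mul_indep hij (exists_ne_ne i j).choose_spec.1 (exists_ne_ne i j).choose_spec.2 hki hkj

/-- Expanding both factors through fresh indices puts a vanishing product of orthogonal units in the
middle. The fresh indices also cover i = l, where the relations on E say nothing directly. -/
theorem offUnit_mul_of_ne [Infinite ι] (h : IsElementary E) {i j k l : ι} (hij : i ≠ j) (hkl : k ≠ l) (hjk : j ≠ k) :
    offUnit E i j * offUnit E k l = 0 := by
  classical
  obtain ⟨m, hm⟩ := exists_fresh {i, j, k, l}
  obtain ⟨n, hn⟩ := exists_fresh {i, j, k, l, m}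
  simp only [Finset.mem_insert, Finset.mem_singleton, not_or] at hm hn
  rw [h.offUnit_eq hij hm.1 hm.2.1, h.offUnit_eq hkl hn.2.2.1 hn.2.2.2.1, mul_assoc,
    ← mul_assoc (E m j), h.mul_eq_zero m j k n hm.2.1 (Ne.symm hn.2.2.1) (Ne.symm hn.2.2.2.2)
      hjk.symm, zero_mul, mul_zero]

theorem offUnit_mul [Infinite ι] (h : IsElementary E) {i j l : ι} (hij : i ≠ j) (hjl : j ≠ l) (hil : i ≠ l) :
    offUnit E i j * offUnit E j l = offUnit E i l := by
  classical
  obtain ⟨k, hk⟩ := exists_fresh {i, j, l}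
  obtain ⟨m, hm⟩ := exists_fresh {i, j, k, l}
  simp only [Finset.mem_insert, Finset.mem_singleton, not_or] at hk hm
  obtain ⟨hki, hkj, hkl⟩ := hk
  obtain ⟨hmi, hmj, hmk, hml⟩ := hm
  have e1 : E k j * E j m = E k m + E j m * E k j :=
    sub_eq_iff_eq_add.1 (h.comm k j m hkj (Ne.symm hmj) (Ne.symm hmk))
  have e2 : E k m * E m l = E k l + E m l * E k m :=
    sub_eq_iff_eq_add.1 (h.comm k m l (Ne.symm hmk) hml hkl)
  rw [h.offUnit_eq hij hki hkj, h.offUnit_eq hjl hmj hml, h.offUnit_eq hil hki hkl]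
  calc E i k * E k j * (E j m * E m l) = E i k * (E k j * E j m) * E m l := by
        simp only [mul_assoc]
    _ = E i k * (E k m * E m l) + (E i k * E j m) * (E k j * E m l) := by
        rw [e1, mul_add, add_mul]; simp only [mul_assoc]
    _ = E i k * E k l + (E i k * E m l) * E k m := by
        rw [e2, h.mul_eq_zero i k j m (Ne.symm hki) (Ne.symm hmj) (Ne.symm hmi) (Ne.symm hkj),
          zero_mul, add_zero, mul_add, mul_assoc]
    _ = E i k * E k l := by
        rw [h.mul_eq_zero i k m l (Ne.symm hki) hml hil hmk, zero_mul, add_zero]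

/-- This is why matrix units are built in two stages. On a conatural summand E i k * E k i acts as
the unit at (k, k), so it depends on k; once off-diagonal products have removed the conatural part,
a second product gives diagonal units independent of k. -/
theorem matUnit_eq [Infinite ι] (h : IsElementary E) {i j k : ι} (hki : k ≠ i) (hkj : k ≠ j) :
    matUnit E i j = offUnit E i k * offUnit E k j := by
  have key : ∀ k', k' ≠ i → k' ≠ j →
      offUnit E i k * offUnit E k j = offUnit E i k' * offUnit E k' j := by
    intro k' hki' hkj'
    by_cases hk : k = k'
    · rw [hk]
    rw [← h.offUnit_mul hki'.symm (Ne.symm hk) hki.symm, mul_assoc, h.offUnit_mul (Ne.symm hk) hkj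
      hkj']
  exact (key _ (exists_ne_ne i j).choose_spec.1 (exists_ne_ne i j).choose_spec.2).symm

theorem matUnit_eq_offUnit [Infinite ι] (h : IsElementary E) {i j : ι} (hij : i ≠ j) : matUnit E i j = offUnit E i j := by
  obtain ⟨k, hki, hkj⟩ := exists_ne_ne i j
  rw [h.matUnit_eq hki hkj, h.offUnit_mul hki.symm hkj hij]

theorem matUnit_mul [Infinite ι] (h : IsElementary E) (i j l : ι) : matUnit E i j * matUnit E j l = matUnit E i l := by
  classical
  obtain ⟨k, hk⟩ := exists_fresh {i, j, l}
  obtain ⟨m, hm⟩ := exists_fresh {i, j, k, l}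
  simp only [Finset.mem_insert, Finset.mem_singleton, not_or] at hk hm
  obtain ⟨hki, hkj, hkl⟩ := hk
  obtain ⟨hmi, hmj, hmk, hml⟩ := hm
  rw [h.matUnit_eq hki hkj, h.matUnit_eq hmj hml, h.matUnit_eq hmi hml, mul_assoc,
    ← mul_assoc (offUnit E k j), h.offUnit_mul hkj (Ne.symm hmj) (Ne.symm hmk), ← mul_assoc,
    h.offUnit_mul (Ne.symm hki) (Ne.symm hmk) (Ne.symm hmi)]

theorem matUnit_mul_of_ne [Infinite ι] (h : IsElementary E) {i j k l : ι} (hjk : j ≠ k) : matUnit E i j * matUnit E k l = 0 := by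
  obtain ⟨m, hmi, hmj⟩ := exists_ne_ne i j
  obtain ⟨n, hnk, hnl⟩ := exists_ne_ne k l
  rw [h.matUnit_eq hmi hmj, h.matUnit_eq hnk hnl, mul_assoc, ← mul_assoc (offUnit E m j),
    h.offUnit_mul_of_ne hmj (Ne.symm hnk) hjk, zero_mul, mul_zero]

theorem offUnit_mul_negTranspose [Infinite ι] (h : IsElementary E) {i j k l : ι} (hij : i ≠ j) (hkl : k ≠ l) :
    offUnit E i j * offUnit (LocFin.negTranspose E) k l = 0 := by
  classical
  obtain ⟨m, hm⟩ := exists_fresh {i, j, k, l}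
  obtain ⟨n, hn⟩ := exists_fresh {i, j, k, l, m}
  simp only [Finset.mem_insert, Finset.mem_singleton, not_or] at hm hn
  rw [h.offUnit_eq hij hm.1 hm.2.1, h.negTranspose.offUnit_eq hkl hn.2.2.1 hn.2.2.2.1]
  simp only [LocFin.negTranspose, neg_mul_neg]
  rw [mul_assoc, ← mul_assoc (E m j),
    h.mul_eq_zero m j n k hm.2.1 hn.2.2.1 hm.2.2.1 hn.2.1, zero_mul, mul_zero]

theorem matUnit_mul_negTranspose [Infinite ι] (h : IsElementary E) (i j k l : ι) :
    matUnit E i j * matUnit (LocFin.negTranspose E) k l = 0 := by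
  obtain ⟨m, hmi, hmj⟩ := exists_ne_ne i j
  obtain ⟨n, hnk, hnl⟩ := exists_ne_ne k l
  rw [h.matUnit_eq hmi hmj, h.negTranspose.matUnit_eq hnk hnl, mul_assoc,
    ← mul_assoc (offUnit E m j), h.offUnit_mul_negTranspose hmj (Ne.symm hnk), zero_mul, mul_zero]

theorem negTranspose_mul_matUnit [Infinite ι] (h : IsElementary E) (i j k l : ι) :
    matUnit (LocFin.negTranspose E) i j * matUnit E k l = 0 := by
  have h2 : LocFin.negTranspose (LocFin.negTranspose E) = E := by
    funext i j; simp [LocFin.negTranspose]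
  have := h.negTranspose.matUnit_mul_negTranspose i j k l
  rwa [h2] at this

/-- The commutator relation E i j = E i k * E k j - E k j * E i k is itself the splitting: its two
products are the off-diagonal units of E and of its negative transpose. -/
theorem eq_matUnit_sub [Infinite ι] (h : IsElementary E) {i j : ι} (hij : i ≠ j) :
    E i j = matUnit E i j - matUnit (LocFin.negTranspose E) j i := by
  obtain ⟨k, hki, hkj⟩ := exists_ne_ne i j
  rw [h.matUnit_eq_offUnit hij, h.negTranspose.matUnit_eq_offUnit hij.symm,
    h.offUnit_eq hij hki hkj, h.negTranspose.offUnit_eq hij.symm hkj hki]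
  simp only [LocFin.negTranspose, neg_mul_neg]
  exact (h.comm i k j hki.symm hkj hij).symm

/-- The diagonal of sl is spanned by differences of diagonal units, which are brackets of
off-diagonal ones; this controls the splitting there. -/
theorem comm_eq_matUnit_sub [Infinite ι] (h : IsElementary E) {i j : ι} (hij : i ≠ j) :
    E i j * E j i - E j i * E i j =
      (matUnit E i i - matUnit (LocFin.negTranspose E) i i) -
        (matUnit E j j - matUnit (LocFin.negTranspose E) j j) := by
  rw [h.eq_matUnit_sub hij, h.eq_matUnit_sub hij.symm]
  simp only [sub_mul, mul_sub, h.matUnit_mul, h.negTranspose.matUnit_mul,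
    h.matUnit_mul_negTranspose, h.negTranspose_mul_matUnit]
  abel

/-- An antiendomorphism negating each E i j sends E i k * E k j to E k j * E i k, hence the natural
family to the conatural one. For sp and so it is applied to the adjoint involution. -/
theorem map_matUnit [Infinite ι] (h : IsElementary E) (σ : R →+ R) (hσ : ∀ a b, σ (a * b) = σ b * σ a)
    (hE : ∀ i j, i ≠ j → σ (E i j) = -E i j) (i j : ι) :
    σ (matUnit E i j) = matUnit (LocFin.negTranspose E) j i := by
  have key : ∀ i j, i ≠ j → σ (offUnit E i j) = offUnit (LocFin.negTranspose E) j i := by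
    intro i j hij
    obtain ⟨k, hki, hkj⟩ := exists_ne_ne i j
    rw [h.offUnit_eq hij hki hkj, h.negTranspose.offUnit_eq hij.symm hkj hki, hσ,
      hE _ _ hki.symm, hE _ _ hkj]
    rfl
  obtain ⟨k, hki, hkj⟩ := exists_ne_ne i j
  rw [h.matUnit_eq hki hkj, h.negTranspose.matUnit_eq hkj hki, hσ, key _ _ hki.symm, key _ _ hkj]

end IsElementary

end MatrixUnits

/-! ### Dual bases -/

section DualBases

universe u v

variable {V : Type u} {W : Type v} [AddCommGroup V] [Module ℂ V] [AddCommGroup W] [Module ℂ W]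

/-- A set of pairs which is biorthonormal for the pairing `p`. -/
def IsDual (p : V →ₗ[ℂ] W →ₗ[ℂ] ℂ) (s : Set (V × W)) : Prop :=
  ∀ a ∈ s, ∀ b ∈ s, (a = b → p a.1 b.2 = 1) ∧ (a ≠ b → p a.1 b.2 = 0)

/-- One Gram–Schmidt step: subtract from v its component along s to get x, choose a vector pairing
to 1 with x, and make it orthogonal to s as well. -/
theorem IsDual.exists_left {p : V →ₗ[ℂ] W →ₗ[ℂ] ℂ} (hp : p.SeparatingLeft) {s : Finset (V × W)}
    (hs : IsDual p (s : Set (V × W))) (v : V) :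
    ∃ t : Finset (V × W), s ⊆ t ∧ IsDual p (t : Set (V × W)) ∧
      v ∈ Submodule.span ℂ (Prod.fst '' (t : Set (V × W))) := by
  classical
  set x : V := v - ∑ a ∈ s, p v a.2 • a.1 with hx
  have hmem : v - x ∈ Submodule.span ℂ (Prod.fst '' (s : Set (V × W))) := by
    rw [hx, sub_sub_cancel]
    exact Submodule.sum_mem _ fun a ha =>
      Submodule.smul_mem _ _ (Submodule.subset_span ⟨a, ha, rfl⟩)
  have hxs : ∀ b ∈ s, p x b.2 = 0 := by
    intro b hb
    rw [hx, map_sub, LinearMap.sub_apply, map_sum, LinearMap.sum_apply, Finset.sum_eq_single b]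
    · simp [(hs b hb b hb).1 rfl]
    · intro a ha hab
      simp [(hs a ha b hb).2 hab]
    · exact fun h => absurd hb h
  by_cases hx0 : x = 0
  · exact ⟨s, subset_rfl, hs, by simpa [hx0] using hmem⟩
  obtain ⟨y₀, hy₀⟩ : ∃ y, p x y ≠ 0 := by
    by_contra! hc
    exact hx0 (hp x hc)
  set y₁ : W := (p x y₀)⁻¹ • y₀
  have hy₁ : p x y₁ = 1 := by simp [y₁, hy₀]
  set y : W := y₁ - ∑ a ∈ s, p a.1 y₁ • a.2 with hy
  have hxy : p x y = 1 := by
    rw [hy, map_sub, map_sum, hy₁, Finset.sum_eq_zero, sub_zero]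
    intro a ha
    simp [hxs a ha]
  have hys : ∀ a ∈ s, p a.1 y = 0 := by
    intro a ha
    rw [hy, map_sub, map_sum, Finset.sum_eq_single a]
    · simp [(hs a ha a ha).1 rfl]
    · intro b hb hba
      simp [(hs a ha b hb).2 (Ne.symm hba)]
    · exact fun h => absurd ha h
  have hnot : ∀ a ∈ s, a ≠ (x, y) := by
    rintro a ha rfl
    have := hxs _ ha
    rw [hxy] at this
    exact one_ne_zero this
  refine ⟨insert (x, y) s, Finset.subset_insert _ _, ?_, ?_⟩
  · intro a ha b hb
    rw [Finset.mem_coe, Finset.mem_insert] at ha hb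
    rcases ha with rfl | ha <;> rcases hb with rfl | hb
    · exact ⟨fun _ => hxy, fun h => absurd rfl h⟩
    · exact ⟨fun h => absurd h.symm (hnot b hb), fun _ => hxs b hb⟩
    · exact ⟨fun h => absurd h (hnot a ha), fun _ => hys a ha⟩
    · exact hs a ha b hb
  · rw [← sub_add_cancel v x]
    refine add_mem (Submodule.span_mono (Set.image_mono ?_) hmem)
      (Submodule.subset_span ⟨(x, y), by simp, rfl⟩)
    exact_mod_cast Finset.subset_insert _ _

theorem IsDual.swap {p : V →ₗ[ℂ] W →ₗ[ℂ] ℂ} {s : Set (V × W)} (hs : IsDual p s) :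
    IsDual p.flip (Prod.swap '' s) := by
  rintro _ ⟨a, ha, rfl⟩ _ ⟨b, hb, rfl⟩
  refine ⟨fun h => (hs b hb a ha).1 (Prod.swap_injective h.symm), fun h => (hs b hb a ha).2 ?_⟩
  rintro rfl
  exact h rfl

theorem IsDual.exists_right {p : V →ₗ[ℂ] W →ₗ[ℂ] ℂ} (hp : p.SeparatingRight) {s : Finset (V × W)}
    (hs : IsDual p (s : Set (V × W))) (w : W) :
    ∃ t : Finset (V × W), s ⊆ t ∧ IsDual p (t : Set (V × W)) ∧
      w ∈ Submodule.span ℂ (Prod.snd '' (t : Set (V × W))) := by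
  classical
  have h1 : IsDual p.flip ((s.image Prod.swap : Finset (W × V)) : Set (W × V)) := by
    rw [Finset.coe_image]; exact hs.swap
  obtain ⟨t, hst, ht, hw⟩ := h1.exists_left (LinearMap.flip_separatingLeft.2 hp) w
  refine ⟨t.image Prod.swap, ?_, ?_, ?_⟩
  · intro a ha
    exact Finset.mem_image.2 ⟨a.swap, hst (Finset.mem_image_of_mem _ ha), by simp⟩
  · rw [Finset.coe_image]; exact ht.swap
  · rw [Finset.coe_image, Set.image_image]
    exact hw

theorem exists_seq_span_eq_top (h : Module.rank ℂ V = Cardinal.aleph0) :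
    ∃ f : ℕ → V, Submodule.span ℂ (Set.range f) = ⊤ := by
  let e := Module.Free.chooseBasis ℂ V
  have hc : Cardinal.mk (Module.Free.ChooseBasisIndex ℂ V) = Cardinal.aleph0 := by
    rw [e.mk_eq_rank'', h]
  have : Countable (Module.Free.ChooseBasisIndex ℂ V) := Cardinal.mk_le_aleph0_iff.1 hc.le
  have : Infinite (Module.Free.ChooseBasisIndex ℂ V) := Cardinal.infinite_iff.2 hc.ge
  obtain ⟨g, hg⟩ := exists_surjective_nat (Module.Free.ChooseBasisIndex ℂ V)
  refine ⟨e ∘ g, ?_⟩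
  rw [hg.range_comp, e.span_eq]

/-- Two spaces of countable dimension in a non-degenerate pairing have dual bases. -/
theorem exists_dual_bases {p : V →ₗ[ℂ] W →ₗ[ℂ] ℂ} (hp : IsCountablePairing p) :
    ∃ (ι : Type (max u v)) (_ : Infinite ι) (_ : DecidableEq ι) (b : Module.Basis ι ℂ V)
      (c : Module.Basis ι ℂ W), ∀ i j, p (b i) (c j) = if i = j then 1 else 0 := by
  classical
  obtain ⟨f, hf⟩ := exists_seq_span_eq_top hp.rank_left
  obtain ⟨g, hg⟩ := exists_seq_span_eq_top hp.rank_right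
  -- Back and forth: stage n absorbs the n-th spanning vector on each side, so the union of the
  -- stages spans both spaces. Biorthogonality gives independence.
  have step : ∀ (s : {s : Finset (V × W) // IsDual p (s : Set (V × W))}) (n : ℕ),
      ∃ t : {s : Finset (V × W) // IsDual p (s : Set (V × W))}, s.1 ⊆ t.1 ∧
        f n ∈ Submodule.span ℂ (Prod.fst '' (t.1 : Set (V × W))) ∧
        g n ∈ Submodule.span ℂ (Prod.snd '' (t.1 : Set (V × W))) := by
    rintro ⟨s, hs⟩ n
    obtain ⟨t, hst, ht, hf⟩ := hs.exists_left hp.nondegenerate.1 (f n)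
    obtain ⟨u, htu, hu, hg⟩ := ht.exists_right hp.nondegenerate.2 (g n)
    refine ⟨⟨u, hu⟩, hst.trans htu, Submodule.span_mono (Set.image_mono ?_) hf, hg⟩
    exact_mod_cast htu
  choose next hsub hfn hgn using step
  let st : ℕ → {s : Finset (V × W) // IsDual p (s : Set (V × W))} := fun n =>
    Nat.rec ⟨∅, by intro a ha; simp at ha⟩ (fun n s => next s n) n
  have hmono : Monotone fun n => (st n).1 := monotone_nat_of_le_succ fun n => hsub (st n) n
  let D : Set (V × W) := ⋃ n, ((st n).1 : Set (V × W))
  have hD : IsDual p D := by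
    intro a ha b hb
    obtain ⟨m, hm⟩ := Set.mem_iUnion.1 ha
    obtain ⟨n, hn⟩ := Set.mem_iUnion.1 hb
    exact (st (max m n)).2 a (hmono (le_max_left m n) hm) b (hmono (le_max_right m n) hn)
  have hp1 : ∀ i j : D, p i.1.1 j.1.2 = if i = j then 1 else 0 := by
    intro i j
    split_ifs with hij
    · exact (hD i i.2 j j.2).1 (congrArg Subtype.val hij)
    · exact (hD i i.2 j j.2).2 fun h => hij (Subtype.ext h)
  have liV : LinearIndependent ℂ (fun i : D => i.1.1) := by
    rw [linearIndependent_iff']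
    intro s c hc i hi
    have := congrArg (fun v => p v i.1.2) hc
    simpa [hp1, hi] using this
  have liW : LinearIndependent ℂ (fun i : D => i.1.2) := by
    rw [linearIndependent_iff']
    intro s c hc i hi
    have := congrArg (fun v => p i.1.1 v) hc
    simpa [hp1, hi] using this
  have spV : ⊤ ≤ Submodule.span ℂ (Set.range fun i : D => i.1.1) := by
    rw [← hf, Submodule.span_le]
    rintro _ ⟨n, rfl⟩
    refine Submodule.span_mono ?_ (hfn (st n) n)
    rintro _ ⟨a, ha, rfl⟩
    exact ⟨⟨a, Set.mem_iUnion.2 ⟨n + 1, ha⟩⟩, rfl⟩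
  have spW : ⊤ ≤ Submodule.span ℂ (Set.range fun i : D => i.1.2) := by
    rw [← hg, Submodule.span_le]
    rintro _ ⟨n, rfl⟩
    refine Submodule.span_mono ?_ (hgn (st n) n)
    rintro _ ⟨a, ha, rfl⟩
    exact ⟨⟨a, Set.mem_iUnion.2 ⟨n + 1, ha⟩⟩, rfl⟩
  let bV := Module.Basis.mk liV spV
  let bW := Module.Basis.mk liW spW
  refine ⟨D, ?_, inferInstance, bV, bW, fun i j => ?_⟩
  · by_contra hfin
    rw [not_infinite_iff_finite] at hfin
    have h1 := Module.rank_lt_aleph0_iff.2 (Module.Finite.of_basis bV)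
    rw [hp.rank_left] at h1
    exact lt_irrefl _ h1
  · simpa [bV, bW] using hp1 i j

end DualBases

/-! ### Trace, finite rank, and the Heisenberg argument -/

section GlFacts

variable {V W : Type*} [AddCommGroup V] [Module ℂ V] [AddCommGroup W] [Module ℂ W]

/-- The trace `V ⊗ V_* → ℂ`. -/
def glTrace (p : V →ₗ[ℂ] W →ₗ[ℂ] ℂ) : Gl p →ₗ[ℂ] ℂ :=
  (TensorProduct.lift p : V ⊗[ℂ] W →ₗ[ℂ] ℂ)

variable {p : V →ₗ[ℂ] W →ₗ[ℂ] ℂ}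

theorem glTrace_tmul (v : V) (w : W) : glTrace p (tmul p v w) = p v w :=
  TensorProduct.lift.tmul v w

theorem tmul_add (v : V) (w w' : W) : tmul p v (w + w') = tmul p v w + tmul p v w' :=
  TensorProduct.tmul_add v w w'

theorem tmul_smul (c : ℂ) (v : V) (w : W) : tmul p v (c • w) = c • tmul p v w :=
  TensorProduct.tmul_smul c v w

theorem add_tmul (v v' : V) (w : W) : tmul p (v + v') w = tmul p v w + tmul p v' w :=
  TensorProduct.add_tmul v v' w

theorem smul_tmul (c : ℂ) (v : V) (w : W) : tmul p (c • v) w = c • tmul p v w :=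
  (TensorProduct.smul_tmul' c v w).symm

theorem glTrace_lie (x y : Gl p) : glTrace p ⁅x, y⁆ = 0 := by
  induction x using gl_induction with
  | zero => simp
  | add a b ha hb => rw [add_lie, map_add, ha, hb, add_zero]
  | tmul v w =>
    induction y using gl_induction with
    | zero => simp
    | add a b ha hb => rw [lie_add, map_add, ha, hb, add_zero]
    | tmul v' w' =>
      rw [tmul_lie_tmul, map_sub, map_smul, map_smul, glTrace_tmul, glTrace_tmul]
      simp [mul_comm]

theorem mem_sl_of_lie (x y : Gl p) : ⁅x, y⁆ ∈ Sl p :=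
  LieSubmodule.lie_mem_lie (LieSubmodule.mem_top x) (LieSubmodule.mem_top y)

theorem glTrace_sl (x : Sl p) : glTrace p x = 0 := by
  have hx : (x : Gl p) ∈ (⁅(⊤ : LieIdeal ℂ (Gl p)), (⊤ : LieIdeal ℂ (Gl p))⁆ :
    LieIdeal ℂ (Gl p)).toSubmodule := x.2
  rw [LieSubmodule.lieIdeal_oper_eq_linear_span'] at hx
  generalize (x : Gl p) = y at hx
  induction hx using Submodule.span_induction with
  | zero => simp
  | add a b _ _ ha hb => rw [map_add, ha, hb, add_zero]
  | smul c a _ ha => rw [map_smul, ha, smul_zero]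
  | mem a ha =>
    obtain ⟨y, -, z, -, rfl⟩ := ha
    exact glTrace_lie y z

/-- The bracket of v ⊗ d and c ⊗ w is v ⊗ w - ⟨v, w⟩ c ⊗ d. Hence sl is exactly the kernel of the
trace. -/
theorem sub_glTrace_mem {c : V} {d : W} (h : p c d = 1) (x : Gl p) :
    x - glTrace p x • tmul p c d ∈ Sl p := by
  induction x using gl_induction with
  | zero => simp
  | add a b ha hb =>
    have : a + b - glTrace p (a + b) • tmul p c d =
        (a - glTrace p a • tmul p c d) + (b - glTrace p b • tmul p c d) := by
      rw [map_add]; module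
    rw [this]
    exact add_mem ha hb
  | tmul v w =>
    have := mem_sl_of_lie (tmul p v d) (tmul p c w)
    rwa [tmul_lie_tmul, h, one_smul] at this

/-- The projection of `gl(V, V_*)` to `sl(V, V_*)` along an element `c ⊗ d` of trace one. -/
def slProj (p : V →ₗ[ℂ] W →ₗ[ℂ] ℂ) {c : V} {d : W} (h : p c d = 1) : Gl p →ₗ[ℂ] Sl p where
  toFun x := ⟨x - glTrace p x • tmul p c d, sub_glTrace_mem h x⟩
  map_add' x y := Subtype.ext (by
    change x + y - glTrace p (x + y) • tmul p c d =
      (x - glTrace p x • tmul p c d) + (y - glTrace p y • tmul p c d)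
    rw [map_add]; module)
  map_smul' r x := Subtype.ext (by
    change r • x - glTrace p (r • x) • tmul p c d = r • (x - glTrace p x • tmul p c d)
    rw [map_smul, smul_eq_mul]; module)

theorem coe_slProj {c : V} {d : W} (h : p c d = 1) (x : Gl p) :
    (slProj p h x : Gl p) = x - glTrace p x • tmul p c d := rfl

theorem slProj_coe {c : V} {d : W} (h : p c d = 1) (x : Sl p) : slProj p h x = x :=
  Subtype.ext (by rw [coe_slProj, glTrace_sl, zero_smul, sub_zero])

theorem slProj_lie {c : V} {d : W} (h : p c d = 1) {x y : Gl p} (hx : glTrace p x = 0)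
    (hy : glTrace p y = 0) : ⁅slProj p h x, slProj p h y⁆ = slProj p h ⁅x, y⁆ :=
  Subtype.ext (by
    rw [LieSubalgebra.coe_bracket, coe_slProj, coe_slProj, coe_slProj, hx, hy, glTrace_lie,
      zero_smul, sub_zero, sub_zero, sub_zero])

/-- Writing a = ∑ b i ⊗ w i in a basis of V, the coefficient of b i in a · x is ⟨x, w i⟩. Identities
in gl can thus be tested on operators of finite rank. -/
theorem natAct_injective (hp : p.SeparatingRight) : Function.Injective (natAct p) := by
  rw [injective_iff_map_eq_zero]
  intro a ha
  let b := Module.Free.chooseBasis ℂ V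
  obtain ⟨c, hc⟩ := TensorProduct.eq_repr_basis_left b (a : V ⊗[ℂ] W)
  have hact : ∀ x : V, natAct₀ p (a : V ⊗[ℂ] W) x = c.sum fun i w => p x w • b i := by
    intro x
    rw [← hc, Finsupp.sum, map_sum, LinearMap.sum_apply]
    exact Finset.sum_congr rfl fun i _ => natAct₀_tmul p _ _ _
  have hc0 : ∀ i, c i = 0 := by
    intro i
    by_cases hi : i ∈ c.support
    · refine hp _ fun x => ?_
      have h0 : natAct₀ p (a : V ⊗[ℂ] W) x = 0 := LinearMap.congr_fun ha x
      rw [hact, Finsupp.sum] at h0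
      exact linearIndependent_iff'.1 b.linearIndependent _ _ h0 i hi
    · simpa using hi
  have : c = 0 := Finsupp.ext hc0
  rw [this, Finsupp.sum_zero_index] at hc
  exact hc.symm

theorem finiteDimensional_range_add {M : Type*} [AddCommGroup M] [Module ℂ M]
    {f g : Module.End ℂ M} (hf : FiniteDimensional ℂ (LinearMap.range f))
    (hg : FiniteDimensional ℂ (LinearMap.range g)) :
    FiniteDimensional ℂ (LinearMap.range (f + g)) := by
  refine Submodule.finiteDimensional_of_le
    (S₂ := LinearMap.range f ⊔ LinearMap.range g) ?_
  rintro _ ⟨x, rfl⟩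
  exact Submodule.add_mem_sup ⟨x, rfl⟩ ⟨x, rfl⟩

theorem finiteDimensional_range_of_forall {M : Type*} [AddCommGroup M] [Module ℂ M]
    {f : Module.End ℂ M} {v : M} (hf : ∀ x, f x ∈ Submodule.span ℂ {v}) :
    FiniteDimensional ℂ (LinearMap.range f) := by
  refine Submodule.finiteDimensional_of_le (S₂ := Submodule.span ℂ {v}) ?_
  rintro _ ⟨x, rfl⟩
  exact hf x

theorem finiteDimensional_range_natAct (a : Gl p) :
    FiniteDimensional ℂ (LinearMap.range (natAct p a)) := by
  induction a using gl_induction with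
  | zero =>
    exact finiteDimensional_range_of_forall (v := 0) fun x => by simp
  | add a b ha hb => rw [map_add]; exact finiteDimensional_range_add ha hb
  | tmul v w =>
    refine finiteDimensional_range_of_forall (v := (v : Natl p)) fun x => ?_
    exact Submodule.mem_span_singleton.2 ⟨p x w, (natAct_tmul p v x w).symm⟩

theorem finiteDimensional_range_conatAct (a : Gl p) :
    FiniteDimensional ℂ (LinearMap.range (conatAct p a)) := by
  induction a using gl_induction with
  | zero =>
    exact finiteDimensional_range_of_forall (v := 0) fun x => by simp
  | add a b ha hb => rw [map_add]; exact finiteDimensional_range_add ha hb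
  | tmul v w =>
    refine finiteDimensional_range_of_forall (v := (w : Conatl p)) fun x => ?_
    refine Submodule.mem_span_singleton.2 ⟨-p v (x : W), ?_⟩
    exact (neg_smul _ (w : W)).trans (conatAct_tmul p v w x).symm

/-- The operator on `V_*` given by minus the conatural action is adjoint to the natural action. -/
theorem pairing_natAct (a : Gl p) (x : V) (y : W) :
    p (natAct p a (x : Natl p) : V) y = -p x (conatAct p a (y : Conatl p) : W) := by
  have : p.flip y ∘ₗ (natAct₀ p).flip x = -(p x ∘ₗ (conatAct₀ p).flip y) :=
    TensorProduct.ext' fun v w => by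
      simp [natAct₀_tmul, conatAct₀_tmul, mul_comm]
  exact LinearMap.congr_fun this a

/-- If `Z` is the central element of an infinite Heisenberg algebra commuting with an operator `X`
of finite rank, then `Z X = 0`. -/
theorem mul_eq_zero_of_heisenberg {M : Type*} [AddCommGroup M] [Module ℂ M] {ι : Type*}
    [Infinite ι] [DecidableEq ι] {X Z : Module.End ℂ M}
    (hX : FiniteDimensional ℂ (LinearMap.range X)) (A B : ι → Module.End ℂ M)
    (hA : ∀ i, A i * X = X * A i) (hB : ∀ i, B i * X = X * B i)
    (hAB : ∀ i j, A i * B j - B j * A i = if i = j then Z else 0) : Z * X = 0 := by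
  refine LinearMap.ext fun u => ?_
  by_contra hu
  obtain ⟨l, hl⟩ : ∃ l : M →ₗ[ℂ] ℂ, l (Z (X u)) ≠ 0 := by
    by_contra! hc
    exact hu ((Module.forall_dual_apply_eq_zero_iff ℂ _).1 hc)
  let I := LinearMap.range X
  have memI : ∀ C : Module.End ℂ M, C * X = X * C → ∀ v, C (X v) ∈ I := fun C hC v =>
    ⟨C v, (LinearMap.congr_fun hC v).symm⟩
  -- The target is finite-dimensional, so some nontrivial combination B of the B j satisfies both B
  -- (X u) = 0 and l ∘ B = 0 on I. Evaluating l on the commutator of A i and B at X u then gives c i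
  -- * l (Z (X u)) = 0.
  let g : ι → I × Module.Dual ℂ I := fun j =>
    (⟨B j (X u), memI _ (hB j) u⟩, (l ∘ₗ B j) ∘ₗ I.subtype)
  have hg : ¬LinearIndependent ℂ g := by
    intro h
    have := h.finite
    exact not_finite ι
  rw [linearIndependent_iff'] at hg
  push Not at hg
  obtain ⟨s, c, hc, i, hi, hci⟩ := hg
  have h1 : ∑ j ∈ s, c j • B j (X u) = 0 := by
    have := congrArg (fun q => ((q.1 : I) : M)) hc
    simpa [g, Prod.fst_sum, Submodule.coe_sum] using this
  have h2 : ∑ j ∈ s, c j • l (B j (A i (X u))) = 0 := by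
    have := congrArg (fun q => q.2 ⟨A i (X u), memI _ (hA i) u⟩) hc
    simpa [g, Prod.snd_sum, LinearMap.sum_apply] using this
  have h3 : ∀ j, l (A i (B j (X u))) - l (B j (A i (X u))) =
      if i = j then l (Z (X u)) else 0 := by
    intro j
    have := congrArg (fun T : Module.End ℂ M => l (T (X u))) (hAB i j)
    simp only [LinearMap.sub_apply, Module.End.mul_apply, map_sub] at this
    rw [this]
    split_ifs <;> simp
  have h4 : ∑ j ∈ s, c j • l (A i (B j (X u))) = 0 := by
    have := congrArg (fun v => l (A i v)) h1
    simpa [map_sum] using this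
  have h5 : ∑ j ∈ s, c j • (l (A i (B j (X u))) - l (B j (A i (X u)))) = 0 := by
    simp only [smul_sub, Finset.sum_sub_distrib]
    rw [h4, h2, sub_zero]
  simp only [h3] at h5
  simp [hi] at h5
  exact h5.elim hci hl

end GlFacts

/-! ### Splitting a homomorphism from `sl` -/

section Split

variable {V' W' V W : Type*} [AddCommGroup V'] [Module ℂ V'] [AddCommGroup W'] [Module ℂ W']
  [AddCommGroup V] [Module ℂ V] [AddCommGroup W] [Module ℂ W]

/-- A homomorphism `α` and an antihomomorphism `β` from the associative algebra `gl(V', V'_*)` to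
an algebra with product `μ`, whose images annihilate each other. -/
structure IsSplitPair {R : Type*} [AddCommGroup R] [Module ℂ R] (μ : R →ₗ[ℂ] R →ₗ[ℂ] R)
    (p' : V' →ₗ[ℂ] W' →ₗ[ℂ] ℂ) (α β : Gl p' →ₗ[ℂ] R) : Prop where
  map_mul : ∀ x y, α (glMul p' x y) = μ (α x) (α y)
  map_mul_rev : ∀ x y, β (glMul p' x y) = μ (β y) (β x)
  mul_eq_zero : ∀ x y, μ (α x) (β y) = 0
  mul_eq_zero' : ∀ x y, μ (β x) (α y) = 0

/-- The associative ring `V ⊗ V_*`. -/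
@[reducible]
def glRing (p : V →ₗ[ℂ] W →ₗ[ℂ] ℂ) : NonUnitalRing (Gl p) where
  mul a b := glMul p a b
  left_distrib a b c := map_add (glMul p a) b c
  right_distrib a b c := by
    change glMul p (a + b) c = glMul p a c + glMul p b c
    rw [map_add, LinearMap.add_apply]
  zero_mul a := by
    change glMul p 0 a = 0
    rw [map_zero, LinearMap.zero_apply]
  mul_zero a := map_zero (glMul p a)
  mul_assoc := glMul_assoc p

theorem gl_basis_ext {ι : Type*} {p' : V' →ₗ[ℂ] W' →ₗ[ℂ] ℂ} (b : Module.Basis ι ℂ V')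
    (c : Module.Basis ι ℂ W') {R : Type*} [AddCommGroup R] [Module ℂ R] {f g : Gl p' →ₗ[ℂ] R}
    (h : ∀ i j, f (tmul p' (b i) (c j)) = g (tmul p' (b i) (c j))) : f = g := by
  have : (f : V' ⊗[ℂ] W' →ₗ[ℂ] R) = g := by
    refine (b.tensorProduct c).ext fun ij => ?_
    rw [Module.Basis.tensorProduct_apply]
    exact h ij.1 ij.2
  exact this

theorem exists_gl_hom {ι : Type*} (p' : V' →ₗ[ℂ] W' →ₗ[ℂ] ℂ) (b : Module.Basis ι ℂ V')
    (c : Module.Basis ι ℂ W') {R : Type*} [AddCommGroup R] [Module ℂ R] (f : ι → ι → R) :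
    ∃ g : Gl p' →ₗ[ℂ] R, ∀ i j, g (tmul p' (b i) (c j)) = f i j := by
  refine ⟨((b.tensorProduct c).constr ℂ fun ij => f ij.1 ij.2 : V' ⊗[ℂ] W' →ₗ[ℂ] R),
    fun i j => ?_⟩
  change ((b.tensorProduct c).constr ℂ fun ij => f ij.1 ij.2 : V' ⊗[ℂ] W' →ₗ[ℂ] R)
    (b i ⊗ₜ c j) = _
  rw [← Module.Basis.tensorProduct_apply b c i j, Module.Basis.constr_basis]

section

variable {ι : Type*} [Infinite ι] [DecidableEq ι] {p' : V' →ₗ[ℂ] W' →ₗ[ℂ] ℂ}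
  {b : Module.Basis ι ℂ V'} {c : Module.Basis ι ℂ W'}

/-- α sends basis units to the matrix units of E, and β sends them to the transposed matrix units of
the negative transpose. The transposition is what makes β reverse products. -/
theorem exists_split_of_isElementary (hbc : ∀ i j, p' (b i) (c j) = if i = j then 1 else 0)
    {p : V →ₗ[ℂ] W →ₗ[ℂ] ℂ} {E : ι → ι → Gl p}
    (hE : letI := glRing p; IsElementary E) :
    ∃ α β : Gl p' →ₗ[ℂ] Gl p, IsSplitPair (glMul p) p' α β ∧
      (∀ i j, i ≠ j → E i j = α (tmul p' (b i) (c j)) - β (tmul p' (b i) (c j))) ∧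
      (∀ i j, i ≠ j → ⁅E i j, E j i⁆ =
        (α (tmul p' (b i) (c i)) - β (tmul p' (b i) (c i))) -
          (α (tmul p' (b j) (c j)) - β (tmul p' (b j) (c j)))) ∧
      ∀ σ : Gl p →ₗ[ℂ] Gl p, (∀ x y, σ (glMul p x y) = glMul p (σ y) (σ x)) →
        (∀ i j, i ≠ j → σ (E i j) = -E i j) → ∀ x, σ (α x) = β x := by
  let := glRing p
  obtain ⟨α, hα⟩ := exists_gl_hom p' b c (matUnit E)
  obtain ⟨β, hβ⟩ := exists_gl_hom p' b c fun i j => matUnit (negTranspose E) j i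
  have ext2 : ∀ f g : Gl p' →ₗ[ℂ] Gl p' →ₗ[ℂ] Gl p,
      (∀ i j k l, f (tmul p' (b i) (c j)) (tmul p' (b k) (c l)) =
        g (tmul p' (b i) (c j)) (tmul p' (b k) (c l))) → ∀ x y, f x y = g x y := by
    intro f g h x y
    have : f = g := gl_basis_ext b c fun i j => gl_basis_ext b c fun k l => h i j k l
    rw [this]
  refine ⟨α, β, ⟨?_, ?_, ?_, ?_⟩, ?_, ?_, ?_⟩
  · refine ext2 ((LinearMap.compr₂ (glMul p') α)) ((glMul p).compl₁₂ α α) fun i j k l => ?_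
    simp only [LinearMap.compr₂_apply, LinearMap.compl₁₂_apply]
    rw [glMul_tmul, map_smul, hα, hα, hα, hbc]
    change _ = matUnit E i j * matUnit E k l
    split_ifs with h
    · subst h; rw [hE.matUnit_mul, one_smul]
    · rw [hE.matUnit_mul_of_ne (Ne.symm h), zero_smul]
  · refine ext2 ((LinearMap.compr₂ (glMul p') β)) ((glMul p).compl₁₂ β β).flip fun i j k l => ?_
    simp only [LinearMap.compr₂_apply, LinearMap.compl₁₂_apply, LinearMap.flip_apply]
    rw [glMul_tmul, map_smul, hβ, hβ, hβ, hbc]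
    change _ = matUnit (negTranspose E) l k * matUnit (negTranspose E) j i
    split_ifs with h
    · subst h; rw [hE.negTranspose.matUnit_mul, one_smul]
    · rw [hE.negTranspose.matUnit_mul_of_ne h, zero_smul]
  · refine ext2 ((glMul p).compl₁₂ α β) 0 fun i j k l => ?_
    simp only [LinearMap.compl₁₂_apply, LinearMap.zero_apply]
    rw [hα, hβ]
    exact hE.matUnit_mul_negTranspose _ _ _ _
  · refine ext2 ((glMul p).compl₁₂ β α) 0 fun i j k l => ?_
    simp only [LinearMap.compl₁₂_apply, LinearMap.zero_apply]
    rw [hα, hβ]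
    exact hE.negTranspose_mul_matUnit _ _ _ _
  · intro i j hij
    rw [hα, hβ]
    exact hE.eq_matUnit_sub hij
  · intro i j hij
    rw [hα, hβ, hα, hβ]
    exact hE.comm_eq_matUnit_sub hij
  · intro σ hσ hσE x
    have : σ ∘ₗ α = β := gl_basis_ext b c fun i j => by
      rw [LinearMap.comp_apply, hα, hβ]
      exact hE.map_matUnit σ.toAddMonoidHom hσ hσE i j
    exact LinearMap.congr_fun this x

end

/-- A homomorphism `sl(V', V'_*) → gl(V, V_*)` is the difference of a homomorphism and an
antihomomorphism of associative algebras `gl(V', V'_*) → gl(V, V_*)`. -/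
theorem exists_split {p' : V' →ₗ[ℂ] W' →ₗ[ℂ] ℂ} (hp' : IsCountablePairing p')
    {p : V →ₗ[ℂ] W →ₗ[ℂ] ℂ} (hp : p.SeparatingRight) (φ : Sl p' →ₗ⁅ℂ⁆ Gl p) :
    ∃ α β : Gl p' →ₗ[ℂ] Gl p, IsSplitPair (glMul p) p' α β ∧ (∀ x : Sl p', φ x = α x - β x) ∧
      ∀ σ : Gl p →ₗ[ℂ] Gl p, (∀ x y, σ (glMul p x y) = glMul p (σ y) (σ x)) →
        (∀ x, σ (φ x) = -φ x) → ∀ x, σ (α x) = β x := by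
  obtain ⟨ι, _, _, b, c, hbc⟩ := exists_dual_bases hp'
  obtain ⟨o⟩ := (inferInstance : Nonempty ι)
  have ho : p' (b o) (c o) = 1 := by rw [hbc, if_pos rfl]
  let e : ι → ι → Gl p' := fun i j => tmul p' (b i) (c j)
  let E : ι → ι → Gl p := fun i j => φ (slProj p' ho (e i j))
  have tr : ∀ i j, i ≠ j → glTrace p' (e i j) = 0 := by
    intro i j hij
    rw [glTrace_tmul, hbc, if_neg hij]
  have comm : ∀ i j k l, i ≠ j → k ≠ l → glMul p (E i j) (E k l) - glMul p (E k l) (E i j) =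
      (if k = j then E i l else 0) - if i = l then E k j else 0 := by
    intro i j k l hij hkl
    rw [← gl_lie_def, ← LieHom.map_lie, slProj_lie ho (tr i j hij) (tr k l hkl), tmul_lie_tmul,
      hbc, hbc, map_sub, map_smul, map_smul, map_sub]
    split_ifs <;> simp [E, e]
  have hE : letI := glRing p; IsElementary E := by
    let := glRing p
    refine ⟨fun i j k l hij hkl hil hkj => ?_, fun i j l hij hjl hil => ?_⟩
    · apply natAct_injective hp
      change natAct p (glMul p (E i j) (E k l)) = _
      rw [natAct_glMul, map_zero]
      -- For m outside s the images of e_im and e_mj are Heisenberg pairs with central element E i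
      -- j, and they commute with E k l because m avoids k and l.
      let s : Finset ι := {i, j, k, l}
      have : Infinite {m // m ∉ s} := (s.finite_toSet.infinite_compl).to_subtype
      have hne : ∀ m : {m // m ∉ s}, m.1 ≠ i ∧ m.1 ≠ j ∧ m.1 ≠ k ∧ m.1 ≠ l := fun m => by
        simpa [s] using m.2
      refine mul_eq_zero_of_heisenberg (ι := {m // m ∉ s})
        (finiteDimensional_range_natAct (E k l))
        (fun m => natAct p (E i m)) (fun m => natAct p (E m j)) ?_ ?_ ?_
      · intro m
        obtain ⟨h1, h2, h3, h4⟩ := hne m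
        rw [← sub_eq_zero, ← natAct_glMul, ← natAct_glMul, ← map_sub, comm _ _ _ _ h1.symm hkl,
          if_neg h3.symm, if_neg hil, sub_zero, map_zero]
      · intro m
        obtain ⟨h1, h2, h3, h4⟩ := hne m
        rw [← sub_eq_zero, ← natAct_glMul, ← natAct_glMul, ← map_sub, comm _ _ _ _ h2 hkl,
          if_neg hkj, if_neg h4, sub_zero, map_zero]
      · intro m n
        obtain ⟨h1, h2, h3, h4⟩ := hne m
        obtain ⟨h1', h2', h3', h4'⟩ := hne n
        rw [← natAct_glMul, ← natAct_glMul, ← map_sub, comm _ _ _ _ h1.symm h2',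
          if_neg hij, sub_zero]
        by_cases hmn : m = n
        · rw [if_pos hmn, if_pos (congrArg Subtype.val hmn.symm)]
        · rw [if_neg hmn, if_neg fun h => hmn (Subtype.ext h.symm), map_zero]
    · change glMul p (E i j) (E j l) - glMul p (E j l) (E i j) = _
      rw [comm _ _ _ _ hij hjl, if_pos rfl, if_neg hil, sub_zero]
  obtain ⟨α, β, hs, h1, h2, h3⟩ := exists_split_of_isElementary hbc hE
  refine ⟨α, β, hs, fun x => ?_, fun σ hσ hφ => h3 σ hσ fun i j _ => hφ _⟩
  -- `slProj` annihilates e o o, so both sides vanish there; the multiple of the trace corrects the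
  -- other diagonal units and disappears on sl.
  have key : (φ : Sl p' →ₗ[ℂ] Gl p) ∘ₗ slProj p' ho =
      (α - β) - (glTrace p').smulRight ((α - β) (e o o)) := by
    refine gl_basis_ext b c fun i j => ?_
    change E i j = (α (e i j) - β (e i j)) - glTrace p' (e i j) • (α (e o o) - β (e o o))
    by_cases hij : i = j
    · subst hij
      have ht : glTrace p' (e i i) = 1 := by rw [glTrace_tmul, hbc, if_pos rfl]
      rw [ht, one_smul]
      by_cases hio : i = o
      · subst hio
        rw [sub_self]
        have : slProj p' ho (e i i) = 0 := Subtype.ext (by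
          rw [coe_slProj, ht, one_smul]; exact sub_self _)
        change φ (slProj p' ho (e i i)) = 0
        rw [this, map_zero]
      · rw [← h2 i o hio, gl_lie_def, comm _ _ _ _ hio (Ne.symm hio), if_pos rfl, if_pos rfl]
        have : E o o = 0 := by
          have ht' : glTrace p' (e o o) = 1 := ho ▸ glTrace_tmul _ _
          have : slProj p' ho (e o o) = 0 := Subtype.ext (by
            rw [coe_slProj, ht', one_smul]; exact sub_self _)
          change φ (slProj p' ho (e o o)) = 0
          rw [this, map_zero]
        rw [this, sub_zero]
    · rw [tr i j hij, zero_smul, sub_zero]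
      exact h1 i j hij
  have := LinearMap.congr_fun key (x : Gl p')
  rw [LinearMap.comp_apply, slProj_coe] at this
  change φ x = (α x - β x) - glTrace p' x • _ at this
  rw [this, glTrace_sl, zero_smul, sub_zero]

end Split

/-! ### The homomorphism attached to a split pair -/

section SplitHom

variable {V' W' V W : Type*} [AddCommGroup V'] [Module ℂ V'] [AddCommGroup W'] [Module ℂ W']
  [AddCommGroup V] [Module ℂ V] [AddCommGroup W] [Module ℂ W]
  {p' : V' →ₗ[ℂ] W' →ₗ[ℂ] ℂ} {p : V →ₗ[ℂ] W →ₗ[ℂ] ℂ}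

/-- The homomorphism of Lie algebras `α - β` attached to a split pair `α`, `β`. -/
def IsSplitPair.lieHom {α β : Gl p' →ₗ[ℂ] Gl p} (h : IsSplitPair (glMul p) p' α β) :
    Gl p' →ₗ⁅ℂ⁆ Gl p where
  __ := α - β
  map_lie' {x y} := by
    change α ⁅x, y⁆ - β ⁅x, y⁆ = ⁅α x - β x, α y - β y⁆
    simp only [gl_lie_def, map_sub, LinearMap.sub_apply, h.map_mul, h.map_mul_rev, h.mul_eq_zero,
      h.mul_eq_zero']
    abel

theorem IsSplitPair.lieHom_apply {α β : Gl p' →ₗ[ℂ] Gl p} (h : IsSplitPair (glMul p) p' α β)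
    (x : Gl p') : h.lieHom x = α x - β x := rfl

theorem exists_pairing_eq_one [Nontrivial V'] (hp' : p'.SeparatingLeft) :
    ∃ c d, p' c d = 1 := by
  obtain ⟨c, hc⟩ := exists_ne (0 : V')
  obtain ⟨d, hd⟩ : ∃ d, p' c d ≠ 0 := by
    by_contra! h
    exact hc (hp' c h)
  exact ⟨c, (p' c d)⁻¹ • d, by simp [hd]⟩

theorem IsCountablePairing.not_finite_left (h : IsCountablePairing p') : ¬Module.Finite ℂ V' := by
  intro hf
  have := Module.rank_lt_aleph0_iff.2 hf
  rw [h.rank_left] at this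
  exact lt_irrefl _ this

theorem IsCountablePairing.exists_eq_one (h : IsCountablePairing p') : ∃ c d, p' c d = 1 := by
  have : Nontrivial V' := by
    by_contra hn
    rw [not_nontrivial_iff_subsingleton] at hn
    exact h.not_finite_left inferInstance
  exact exists_pairing_eq_one h.nondegenerate.1

/-- The Lie algebra `gl(V, V_*)` has trivial center. -/
theorem eq_zero_of_forall_lie_eq_zero (hp' : IsCountablePairing p') {x : Gl p'}
    (hx : ∀ y : Gl p', ⁅x, y⁆ = 0) : x = 0 := by
  obtain ⟨c, d, hcd⟩ := hp'.exists_eq_one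
  set r : ℂ := p' (natAct₀ p' x c) d
  have h1 : ∀ v : V', natAct₀ p' x v = r • v := by
    intro v
    -- Commuting with every v ⊗ d, evaluated at c, forces x to act as the scalar r. A nonzero scalar
    -- would contradict finite rank.
    have h2 : glMul p' x (tmul p' v d) = glMul p' (tmul p' v d) x := sub_eq_zero.1 (hx _)
    have h3 := congrArg (natAct p') h2
    rw [natAct_glMul, natAct_glMul] at h3
    have h4 := LinearMap.congr_fun h3 c
    change natAct₀ p' x (natAct₀ p' (v ⊗ₜ d) c) = natAct₀ p' (v ⊗ₜ d) (natAct₀ p' x c) at h4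
    rwa [natAct₀_tmul, natAct₀_tmul, hcd, one_smul] at h4
  by_cases hr : r = 0
  · refine natAct_injective hp'.nondegenerate.2 (LinearMap.ext fun v => ?_)
    rw [map_zero]
    refine (h1 v).trans ?_
    rw [hr]
    exact zero_smul ℂ (v : V')
  · exfalso
    have htop : LinearMap.range (natAct p' x) = ⊤ := by
      rw [LinearMap.range_eq_top]
      exact fun v => ⟨(r⁻¹ • (v : V') : V'), (h1 _).trans (smul_inv_smul₀ hr (v : V'))⟩
    have hfin := finiteDimensional_range_natAct x
    rw [htop] at hfin
    exact hp'.not_finite_left (Module.Finite.equiv (Submodule.topEquiv (R := ℂ) (M := Natl p')))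

/-- If ψ x = 0, then ψ annihilates every bracket of x with y; these lie in sl, so they vanish and x
is central. -/
theorem injective_of_injective_sl (hp' : IsCountablePairing p') {L : Type*} [LieRing L]
    [LieAlgebra ℂ L] {φ : Sl p' →ₗ⁅ℂ⁆ L} (hφ : Function.Injective φ) {ψ : Gl p' →ₗ⁅ℂ⁆ L}
    (h : ∀ x : Sl p', ψ x = φ x) : Function.Injective ψ := by
  rw [injective_iff_map_eq_zero]
  intro x hx
  refine eq_zero_of_forall_lie_eq_zero hp' fun y => ?_
  have h1 := h ⟨⁅x, y⁆, mem_sl_of_lie x y⟩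
  change ψ ⁅x, y⁆ = _ at h1
  rw [LieHom.map_lie, hx, zero_lie] at h1
  have := (injective_iff_map_eq_zero φ).1 hφ _ h1.symm
  exact congrArg Subtype.val this

end SplitHom

/-! ### Socles of modules given by split pairs -/

section Socle

/-- The image of f is zero or a simple submodule. The hypothesis admits M = 0, so no nontriviality
has to be checked. -/
theorem mem_socle_of_simple {L : Type*} [LieRing L] [LieAlgebra ℂ L] {M N : Type*}
    [AddCommGroup M] [Module ℂ M] [LieRingModule L M] [LieModule ℂ L M]
    [AddCommGroup N] [Module ℂ N] [LieRingModule L N] [LieModule ℂ L N]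
    (hM : ∀ S : LieSubmodule ℂ L M, S = ⊥ ∨ S = ⊤) (f : M →ₗ⁅ℂ,L⁆ N) (m : M) :
    f m ∈ socle L N := by
  by_cases hf : f.range = ⊥
  · have : f m ∈ f.range := (f.mem_range _).2 ⟨m, rfl⟩
    rw [hf, LieSubmodule.mem_bot] at this
    rw [this]
    exact zero_mem _
  · have hatom : IsAtom f.range := by
      refine ⟨hf, fun S hS => ?_⟩
      rcases hM (S.comap f) with h | h
      · rw [LieSubmodule.eq_bot_iff]
        intro n hn
        obtain ⟨x, rfl⟩ := (f.mem_range _).1 (hS.le hn)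
        have : x ∈ S.comap f := hn
        rw [h, LieSubmodule.mem_bot] at this
        rw [this, map_zero]
      · refine absurd hS.le fun _ => hS.not_ge ?_
        intro n hn
        obtain ⟨x, rfl⟩ := (f.mem_range _).1 hn
        have : x ∈ S.comap f := h ▸ LieSubmodule.mem_top x
        exact this
    exact le_sSup (α := LieSubmodule ℂ L N) hatom ((f.mem_range _).2 ⟨m, rfl⟩)

/-- Each nonzero invariant vector spans a simple submodule. -/
theorem maxTrivSubmodule_le_socle (L N : Type*) [LieRing L] [LieAlgebra ℂ L]
    [AddCommGroup N] [Module ℂ N] [LieRingModule L N] [LieModule ℂ L N] :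
    LieModule.maxTrivSubmodule ℂ L N ≤ socle L N := by
  intro w hw
  rw [LieModule.mem_maxTrivSubmodule] at hw
  by_cases hw0 : w = 0
  · rw [hw0]; exact LieSubmodule.zero_mem (socle L N)
  let S : LieSubmodule ℂ L N :=
    { Submodule.span ℂ {w} with
      lie_mem := by
        intro x m hm
        obtain ⟨c, rfl⟩ := Submodule.mem_span_singleton.1 hm
        rw [lie_smul, hw, smul_zero]
        exact (Submodule.span ℂ {w}).zero_mem }
  have hS : w ∈ S := Submodule.mem_span_singleton_self w
  have hatom : IsAtom S := by
    refine ⟨fun h => hw0 ?_, fun T hT => ?_⟩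
    · rwa [h, LieSubmodule.mem_bot] at hS
    · rw [LieSubmodule.eq_bot_iff]
      intro n hn
      obtain ⟨c, rfl⟩ := Submodule.mem_span_singleton.1 (hT.le hn)
      by_cases hc : c = 0
      · rw [hc, zero_smul]
      · refine absurd hT.le fun _ => hT.not_ge ?_
        intro y hy
        obtain ⟨e, rfl⟩ := Submodule.mem_span_singleton.1 hy
        have := T.smul_mem (e * c⁻¹) hn
        rwa [smul_smul, inv_mul_cancel_right₀ hc] at this
  exact le_sSup (α := LieSubmodule ℂ L N) hatom hS

/-- The homomorphism from a finite direct sum given by its restrictions to the summands. -/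
def directSumHom {L M N : Type*} [LieRing L] [LieAlgebra ℂ L]
    [AddCommGroup M] [Module ℂ M] [LieRingModule L M] [LieModule ℂ L M]
    [AddCommGroup N] [Module ℂ N] [LieRingModule L N] [LieModule ℂ L N] {n : ℕ}
    (f : Fin n → M →ₗ⁅ℂ,L⁆ N) : (⨁ _ : Fin n, M) →ₗ⁅ℂ,L⁆ N where
  toFun m := ∑ i, f i (m i)
  map_add' x y := by simp [Finset.sum_add_distrib]
  map_smul' c x := by
    rw [RingHom.id_apply, Finset.smul_sum]
    exact Finset.sum_congr rfl fun i _ => (f i).map_smul c (x i)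
  map_lie' {x m} := by simp [lie_sum]

theorem directSumHom_apply {L M N : Type*} [LieRing L] [LieAlgebra ℂ L]
    [AddCommGroup M] [Module ℂ M] [LieRingModule L M] [LieModule ℂ L M]
    [AddCommGroup N] [Module ℂ N] [LieRingModule L N] [LieModule ℂ L N] {n : ℕ}
    (f : Fin n → M →ₗ⁅ℂ,L⁆ N) (m : ⨁ _ : Fin n, M) : directSumHom f m = ∑ i, f i (m i) := rfl

theorem exists_directSum {M : Type*} [AddCommGroup M] {n : ℕ} (g : Fin n → M) :
    ∃ m : ⨁ _ : Fin n, M, ∀ i, m i = g i := by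
  classical
  exact ⟨DFinsupp.equivFunOnFintype.symm g, fun i => rfl⟩

variable {V' W' : Type*} [AddCommGroup V'] [Module ℂ V'] [AddCommGroup W'] [Module ℂ W']
  {p' : V' →ₗ[ℂ] W' →ₗ[ℂ] ℂ}

/-- A rank one operator carries a given nonzero vector to any prescribed vector. -/
theorem natl_simple (hp' : p'.SeparatingLeft) (S : LieSubmodule ℂ (Gl p') (Natl p')) :
    S = ⊥ ∨ S = ⊤ := by
  refine or_iff_not_imp_left.2 fun hS => ?_
  obtain ⟨v, hv, hv0⟩ : ∃ v ∈ S, v ≠ 0 := by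
    by_contra! h
    exact hS ((LieSubmodule.eq_bot_iff _).2 h)
  obtain ⟨w, hw⟩ : ∃ w, p' v w ≠ 0 := by
    by_contra! h
    exact hv0 (hp' v h)
  rw [eq_top_iff]
  intro a _
  have h1 : ⁅tmul p' ((p' v w)⁻¹ • (a : V')) w, v⁆ = a := by
    exact (tmul_lie_nat p' _ _ _).trans (smul_inv_smul₀ hw (a : V'))
  rw [← h1]
  exact S.lie_mem hv

theorem conatl_simple (hp' : p'.SeparatingRight) (S : LieSubmodule ℂ (Gl p') (Conatl p')) :
    S = ⊥ ∨ S = ⊤ := by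
  refine or_iff_not_imp_left.2 fun hS => ?_
  obtain ⟨w, hw, hw0⟩ : ∃ w ∈ S, w ≠ 0 := by
    by_contra! h
    exact hS ((LieSubmodule.eq_bot_iff _).2 h)
  obtain ⟨v, hv⟩ : ∃ v, p' v w ≠ 0 := by
    by_contra! h
    exact hw0 (hp' w h)
  rw [eq_top_iff]
  intro a _
  have h1 : ⁅tmul p' v (-((p' v w)⁻¹ • (a : W'))), w⁆ = a := by
    refine (tmul_lie_conat p' _ _ _).trans ?_
    exact ((congrArg Neg.neg (smul_neg (p' v w) ((p' v w)⁻¹ • (a : W')))).trans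
      (neg_neg _)).trans (smul_inv_smul₀ hv (a : W'))
  rw [← h1]
  exact S.lie_mem hw

theorem tmul_natAct (x : Gl p') (a : V') (d : W') :
    tmul p' (natAct₀ p' x a) d = glMul p' x (tmul p' a d) := by
  rfl

theorem tmul_conatAct (x : Gl p') (c : V') (b : W') :
    tmul p' c (conatAct₀ p' x b) = -glMul p' (tmul p' c b) x := by
  have : TensorProduct.mk ℂ V' W' c ∘ₗ (conatAct₀ p').flip b = -glMul p' (tmul p' c b) :=
    TensorProduct.ext' fun v w => by
      change c ⊗ₜ[ℂ] conatAct₀ p' (v ⊗ₜ w) b = -glMul p' (tmul p' c b) (tmul p' v w)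
      rw [glMul_tmul, conatAct₀_tmul, ← neg_smul, ← neg_smul]
      exact TensorProduct.tmul_smul _ c w
  exact LinearMap.congr_fun this x

variable {W : Type*} [AddCommGroup W] [Module ℂ W] {α β : Gl p' →ₗ[ℂ] Module.End ℂ W}

namespace IsSplitPair

theorem hom_hom (h : IsSplitPair (LinearMap.mul ℂ (Module.End ℂ W)) p' α β)
    (x y : Gl p') (w : W) : α x (α y w) = α (glMul p' x y) w :=
  (LinearMap.congr_fun (h.map_mul x y) w).symm

theorem anti_anti (h : IsSplitPair (LinearMap.mul ℂ (Module.End ℂ W)) p' α β)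
    (x y : Gl p') (w : W) : β x (β y w) = β (glMul p' y x) w :=
  (LinearMap.congr_fun (h.map_mul_rev y x) w).symm

theorem hom_anti (h : IsSplitPair (LinearMap.mul ℂ (Module.End ℂ W)) p' α β)
    (x y : Gl p') (w : W) : α x (β y w) = 0 :=
  LinearMap.congr_fun (h.mul_eq_zero x y) w

theorem anti_hom (h : IsSplitPair (LinearMap.mul ℂ (Module.End ℂ W)) p' α β)
    (x y : Gl p') (w : W) : β x (α y w) = 0 :=
  LinearMap.congr_fun (h.mul_eq_zero' x y) w

theorem hom_tmul_hom_tmul (h : IsSplitPair (LinearMap.mul ℂ (Module.End ℂ W)) p' α β)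
    (a c : V') (b d : W') (w : W) :
    α (tmul p' a b) (α (tmul p' c d) w) = p' c b • α (tmul p' a d) w := by
  rw [h.hom_hom, glMul_tmul, map_smul, LinearMap.smul_apply]

theorem anti_tmul_anti_tmul (h : IsSplitPair (LinearMap.mul ℂ (Module.End ℂ W)) p' α β)
    (a c : V') (b d : W') (w : W) :
    β (tmul p' a b) (β (tmul p' c d) w) = p' a d • β (tmul p' c b) w := by
  rw [h.anti_anti, glMul_tmul, map_smul, LinearMap.smul_apply]

/-- The homomorphism `a ↦ α (a ⊗ d) u` from the natural module. -/
def natHom [LieRingModule (Gl p') W] [LieModule ℂ (Gl p') W]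
    (h : IsSplitPair (LinearMap.mul ℂ (Module.End ℂ W)) p' α β)
    (hact : ∀ (x : Gl p') (w : W), ⁅x, w⁆ = α x w - β x w) (d : W') (u : W) : Natl p' →ₗ⁅ℂ,Gl p'⁆ W where
  toFun a := α (tmul p' a d) u
  map_add' a b := by
    rw [← LinearMap.add_apply, ← map_add]
    exact congrArg (fun x => α x u) (add_tmul (p := p') a b d)
  map_smul' c a := by
    rw [RingHom.id_apply, ← LinearMap.smul_apply, ← map_smul]
    exact congrArg (fun x => α x u) (smul_tmul (p := p') c a d)
  map_lie' {x a} := by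
    rw [hact]
    refine (congrArg (fun y => α y u) (tmul_natAct x a d)).trans ?_
    rw [h.anti_hom, sub_zero, h.hom_hom]

/-- The homomorphism `b ↦ β (c ⊗ b) u` from the conatural module. -/
def conatHom [LieRingModule (Gl p') W] [LieModule ℂ (Gl p') W]
    (h : IsSplitPair (LinearMap.mul ℂ (Module.End ℂ W)) p' α β)
    (hact : ∀ (x : Gl p') (w : W), ⁅x, w⁆ = α x w - β x w) (c : V') (u : W) : Conatl p' →ₗ⁅ℂ,Gl p'⁆ W where
  toFun b := β (tmul p' c b) u
  map_add' a b := by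
    rw [← LinearMap.add_apply, ← map_add]
    exact congrArg (fun x => β x u) (tmul_add (p := p') c a b)
  map_smul' r b := by
    rw [RingHom.id_apply, ← LinearMap.smul_apply, ← map_smul]
    exact congrArg (fun x => β x u) (tmul_smul (p := p') r c b)
  map_lie' {x b} := by
    rw [hact]
    refine (congrArg (fun y => β y u) (tmul_conatAct x c b)).trans ?_
    rw [h.hom_anti, zero_sub, h.anti_anti, map_neg, LinearMap.neg_apply]

/-- On an invariant vector α and β agree, so α(a ⊗ b) w = α(a ⊗ d) α(c ⊗ b) w = α(a ⊗ d) β(c ⊗ b) w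
= 0. This makes the trivial summand independent of the others. -/
theorem hom_eq_zero_of_invariant [LieRingModule (Gl p') W]
    (h : IsSplitPair (LinearMap.mul ℂ (Module.End ℂ W)) p' α β)
    (hact : ∀ (x : Gl p') (w : W), ⁅x, w⁆ = α x w - β x w) {c : V'} {d : W'}
    (hcd : p' c d = 1) {w : W} (hw : ∀ x : Gl p', ⁅x, w⁆ = 0) (a : V') (b : W') :
    α (tmul p' a b) w = 0 ∧ β (tmul p' a b) w = 0 := by
  have h1 : ∀ x, α x w = β x w := fun x => by
    have := hw x
    rwa [hact, sub_eq_zero] at this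
  have h2 : α (tmul p' a b) w = 0 := by
    have := h.hom_tmul_hom_tmul a c d b w
    rw [hcd, one_smul, h1 (tmul p' c b), h.hom_anti] at this
    exact this.symm
  exact ⟨h2, by rw [← h1, h2]⟩

/-- The socle of the `gl(V', V'_*)`-module given by a split pair of finite rank. -/
theorem hasTensorSocle [LieRingModule (Gl p') W] [LieModule ℂ (Gl p') W]
    (h : IsSplitPair (LinearMap.mul ℂ (Module.End ℂ W)) p' α β)
    (hact : ∀ (x : Gl p') (w : W), ⁅x, w⁆ = α x w - β x w) (hp' : p'.Nondegenerate) {c : V'}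
    {d : W'} (hcd : p' c d = 1)
    (hα : FiniteDimensional ℂ (LinearMap.range (α (tmul p' c d))))
    (hβ : FiniteDimensional ℂ (LinearMap.range (β (tmul p' c d))))
    (hW : Module.rank ℂ W ≤ Cardinal.aleph0) :
    HasTensorSocle (Gl p') W (Natl p') (Conatl p')
      (Module.finrank ℂ (LinearMap.range (α (tmul p' c d))))
      (Module.finrank ℂ (LinearMap.range (β (tmul p' c d)))) := by
  set k := Module.finrank ℂ (LinearMap.range (α (tmul p' c d)))
  set l := Module.finrank ℂ (LinearMap.range (β (tmul p' c d)))
  -- Both operators at c ⊗ d are idempotent because ⟨c, d⟩ = 1. Bases of their ranges index the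
  -- copies of V' and of V'_*.
  let u := Module.finBasis ℂ (LinearMap.range (α (tmul p' c d)))
  let q := Module.finBasis ℂ (LinearMap.range (β (tmul p' c d)))
  have hu : ∀ (a : V') (b : W') (v : LinearMap.range (α (tmul p' c d))),
      α (tmul p' c b) (α (tmul p' a d) v) = p' a b • (v : W) := by
    rintro a b ⟨_, v, rfl⟩
    rw [h.hom_tmul_hom_tmul, h.hom_tmul_hom_tmul, hcd, one_smul]
  have hq : ∀ (a : V') (b : W') (v : LinearMap.range (β (tmul p' c d))),
      β (tmul p' a d) (β (tmul p' c b) v) = p' a b • (v : W) := by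
    rintro a b ⟨_, v, rfl⟩
    rw [h.anti_tmul_anti_tmul, h.anti_tmul_anti_tmul, hcd, one_smul]
  let F := directSumHom fun i => natHom h hact d (u i : W)
  let G := directSumHom fun i => conatHom h hact c (q i : W)
  let Na := LieModule.maxTrivSubmodule ℂ (Gl p') W
  have hF : ∀ m, F m = ∑ i, α (tmul p' (m i) d) (u i : W) := fun m => rfl
  have hG : ∀ m, G m = ∑ i, β (tmul p' c (m i)) (q i : W) := fun m => rfl
  have memF : ∀ (a : V') (b : W') (w : W), ∃ m, F m = α (tmul p' a b) w := by
    intro a b w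
    let v : LinearMap.range (α (tmul p' c d)) := ⟨α (tmul p' c b) w, α (tmul p' c b) w, by
      rw [h.hom_tmul_hom_tmul, hcd, one_smul]⟩
    obtain ⟨m, hm⟩ := exists_directSum (M := Natl p') fun i => (u.repr v i • (a : V') : V')
    refine ⟨m, ?_⟩
    have e : α (tmul p' a d) (v : W) = α (tmul p' a b) w := by
      change α (tmul p' a d) (α (tmul p' c b) w) = _
      rw [h.hom_tmul_hom_tmul, hcd, one_smul]
    rw [hF, ← e, ← u.sum_repr v, Submodule.coe_sum, map_sum]
    refine Finset.sum_congr rfl fun i _ => ?_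
    rw [hm, smul_tmul, map_smul, LinearMap.smul_apply, Submodule.coe_smul, map_smul]
  have memG : ∀ (a : V') (b : W') (w : W), ∃ m, G m = β (tmul p' a b) w := by
    intro a b w
    let v : LinearMap.range (β (tmul p' c d)) := ⟨β (tmul p' a d) w, β (tmul p' a d) w, by
      rw [h.anti_tmul_anti_tmul, hcd, one_smul]⟩
    obtain ⟨m, hm⟩ := exists_directSum (M := Conatl p') fun i => (q.repr v i • (b : W') : W')
    refine ⟨m, ?_⟩
    have e : β (tmul p' c b) (v : W) = β (tmul p' a b) w := by
      change β (tmul p' c b) (β (tmul p' a d) w) = _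
      rw [h.anti_tmul_anti_tmul, hcd, one_smul]
    rw [hG, ← e, ← q.sum_repr v, Submodule.coe_sum, map_sum]
    refine Finset.sum_congr rfl fun i _ => ?_
    rw [hm, tmul_smul, map_smul, LinearMap.smul_apply, Submodule.coe_smul, map_smul]
  let Φ : ((⨁ _ : Fin k, Natl p') × (⨁ _ : Fin l, Conatl p') × Na) →ₗ⁅ℂ,Gl p'⁆ W :=
    { toFun := fun m => F m.1 + (G m.2.1 + (m.2.2 : W))
      map_add' := fun x y => by
        change F (x.1 + y.1) + (G (x.2.1 + y.2.1) + ((x.2.2 : W) + y.2.2)) = _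
        rw [map_add, map_add]; abel
      map_smul' := fun r x => by
        change F (r • x.1) + (G (r • x.2.1) + (r • (x.2.2 : W))) = r • (_ + (_ + _))
        rw [map_smul, map_smul, smul_add, smul_add]
      map_lie' := fun {x m} => by
        change F ⁅x, m.1⁆ + (G ⁅x, m.2.1⁆ + ⁅x, (m.2.2 : W)⁆) = ⁅x, F m.1 + (G m.2.1 + (m.2.2 : W))⁆
        rw [LieModuleHom.map_lie, LieModuleHom.map_lie, lie_add, lie_add] }
  have hΦ : ∀ m, Φ m = F m.1 + (G m.2.1 + (m.2.2 : W)) := fun m => rfl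
  -- Used twice: it makes the quotient by the socle trivial, and it makes any nontrivial simple
  -- submodule meet the image of Φ, hence lie in it.
  have hlie : ∀ (x : Gl p') (w : W), ⁅x, w⁆ ∈ Φ.range := by
    intro x w
    induction x using gl_induction with
    | zero => rw [zero_lie]; exact zero_mem _
    | add x y hx hy => rw [add_lie]; exact add_mem hx hy
    | tmul a b =>
      obtain ⟨m, hm⟩ := memF a b w
      obtain ⟨n, hn⟩ := memG a b w
      refine (Φ.mem_range _).2 ⟨(m, -n, 0), ?_⟩
      rw [hΦ, hact]
      change F m + (G (-n) + 0) = _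
      rw [map_neg, hm, hn, add_zero, sub_eq_add_neg]
  have hinj : Function.Injective Φ := by
    rw [injective_iff_map_eq_zero]
    rintro ⟨m, n, z⟩ hm
    rw [hΦ] at hm
    change F m + (G n + (z : W)) = 0 at hm
    have hz : ∀ (a : V') (b : W'), α (tmul p' a b) (z : W) = 0 ∧ β (tmul p' a b) (z : W) = 0 :=
      h.hom_eq_zero_of_invariant hact hcd z.2
    have hm0 : m = 0 := by
      have key : ∀ b : W', ∑ i, p' (m i) b • (u i : W) = 0 := by
        intro b
        have := congrArg (α (tmul p' c b)) hm
        rw [map_add, map_add, (hz c b).1, map_zero, hF, hG, map_sum, map_sum,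
          Finset.sum_eq_zero fun i _ => h.hom_anti _ _ _, add_zero, add_zero] at this
        rw [← this]
        exact Finset.sum_congr rfl fun i _ => (hu _ _ _).symm
      have key2 : ∀ (b : W') i, p' (m i) b = 0 := by
        intro b
        have : ∑ i, p' (m i) b • u i = 0 := Subtype.ext (by
          rw [Submodule.coe_sum]
          exact key b)
        exact Fintype.linearIndependent_iff.1 u.linearIndependent _ this
      exact DFinsupp.ext fun i => hp'.1 _ fun b => key2 b i
    have hn0 : n = 0 := by
      have key : ∀ a : V', ∑ i, p' a (n i) • (q i : W) = 0 := by
        intro a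
        have := congrArg (β (tmul p' a d)) hm
        rw [map_add, map_add, (hz a d).2, map_zero, hF, hG, map_sum, map_sum,
          Finset.sum_eq_zero fun i _ => h.anti_hom _ _ _, zero_add, add_zero] at this
        rw [← this]
        exact Finset.sum_congr rfl fun i _ => (hq _ _ _).symm
      have key2 : ∀ (a : V') i, p' a (n i) = 0 := by
        intro a
        have : ∑ i, p' a (n i) • q i = 0 := Subtype.ext (by
          rw [Submodule.coe_sum]
          exact key a)
        exact Fintype.linearIndependent_iff.1 q.linearIndependent _ this
      exact DFinsupp.ext fun i => hp'.2 _ fun a => key2 a i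
    subst hm0 hn0
    rw [map_zero, map_zero, zero_add, zero_add] at hm
    have : z = 0 := Subtype.ext hm
    rw [this]
    rfl
  have hrange : ∀ m, Φ m ∈ socle (Gl p') W := by
    intro m
    refine add_mem ?_ (add_mem ?_ (maxTrivSubmodule_le_socle _ _ m.2.2.2))
    · rw [directSumHom_apply]
      exact sum_mem fun i _ => mem_socle_of_simple (natl_simple hp'.1) (natHom h hact d (u i : W)) _
    · rw [directSumHom_apply]
      exact sum_mem fun i _ =>
        mem_socle_of_simple (conatl_simple hp'.2) (conatHom h hact c (q i : W)) _
  have hsocle : ∀ w ∈ socle (Gl p') W, ∃ m, Φ m = w := by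
    have : socle (Gl p') W ≤ Φ.range := by
      refine sSup_le fun S hS => ?_
      by_cases hS0 : ∀ (x : Gl p') (s : W), s ∈ S → ⁅x, s⁆ = 0
      · intro s hs
        refine (Φ.mem_range _).2 ⟨(0, 0, ⟨s, fun x => hS0 x s hs⟩), ?_⟩
        rw [hΦ]
        change F 0 + (G 0 + s) = s
        rw [map_zero, map_zero, zero_add, zero_add]
      · push Not at hS0
        obtain ⟨x, s, hs, hxs⟩ := hS0
        have h1 : S ⊓ Φ.range ≠ ⊥ := fun hbot => hxs <| by
          rw [← LieSubmodule.mem_bot (R := ℂ) (L := Gl p'), ← hbot]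
          exact (LieSubmodule.mem_inf _ _ _).2 ⟨S.lie_mem hs, hlie x s⟩
        have h2 : S ⊓ Φ.range = S := by
          by_contra hne
          exact h1 (hS.2 _ (lt_of_le_of_ne inf_le_left hne))
        exact h2 ▸ inf_le_right
    intro w hw
    exact (Φ.mem_range _).1 (this hw)
  let Φ' := Φ.codRestrict (socle (Gl p') W) hrange
  have hbij : Function.Bijective Φ' := by
    refine ⟨fun x y hxy => hinj (congrArg Subtype.val hxy), fun ⟨w, hw⟩ => ?_⟩
    obtain ⟨m, hm⟩ := hsocle w hw
    exact ⟨m, Subtype.ext hm⟩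
  let e : ((⨁ _ : Fin k, Natl p') × (⨁ _ : Fin l, Conatl p') × Na) ≃ₗ⁅ℂ,Gl p'⁆
      socle (Gl p') W :=
    { Φ' with
      invFun := (Equiv.ofBijective Φ' hbij).symm
      left_inv := (Equiv.ofBijective Φ' hbij).left_inv
      right_inv := (Equiv.ofBijective Φ' hbij).right_inv }
  refine ⟨⟨Na, inferInstance, ?_, ⟨e.symm⟩⟩, ⟨fun x m => ?_⟩, ?_⟩
  · exact (Submodule.rank_le Na.toSubmodule).trans hW
  · obtain ⟨w, rfl⟩ := LieSubmodule.Quotient.surjective_mk' _ m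
    rw [← LieModuleHom.map_lie, LieSubmodule.Quotient.mk_eq_zero]
    obtain ⟨m, hm⟩ := (Φ.mem_range _).1 (hlie x w)
    rw [← hm]
    exact hrange m
  · exact (rank_quotient_le (socle (Gl p') W).toSubmodule).trans hW

/-- Finitely many vectors are annihilated by both members of a split pair of finite rank, on
subspaces of finite codimension. -/
theorem exists_cofg (h : IsSplitPair (LinearMap.mul ℂ (Module.End ℂ W)) p' α β)
    {c : V'} {d : W'} (hcd : p' c d = 1)
    (hα : FiniteDimensional ℂ (LinearMap.range (α (tmul p' c d))))
    (hβ : FiniteDimensional ℂ (LinearMap.range (β (tmul p' c d)))) (s : Finset W) :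
    ∃ (A : Submodule ℂ V') (B : Submodule ℂ W'), A.CoFG ∧ B.CoFG ∧
      ∀ a ∈ A, ∀ b ∈ B, ∀ w ∈ s, α (tmul p' a b) w = 0 ∧ β (tmul p' a b) w = 0 := by
  classical
  induction s using Finset.induction_on with
  | empty => exact ⟨⊤, ⊤, inferInstance, inferInstance, by simp⟩
  | insert w s hw ih =>
    obtain ⟨A, B, hA, hB, hAB⟩ := ih
    -- Since α(a ⊗ b) w = α(a ⊗ d) α(c ⊗ b) w, it is enough that f b = 0. The values of f lie in the
    -- finite-dimensional range of α(c ⊗ d), so its kernel has finite codimension; g does the same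
    -- for β.
    let f : W' →ₗ[ℂ] W :=
      { toFun := fun b => α (tmul p' c b) w
        map_add' := fun a b => by rw [tmul_add, map_add, LinearMap.add_apply]
        map_smul' := fun r b => by rw [tmul_smul, map_smul, LinearMap.smul_apply]; rfl }
    let g : V' →ₗ[ℂ] W :=
      { toFun := fun a => β (tmul p' a d) w
        map_add' := fun a b => by rw [add_tmul, map_add, LinearMap.add_apply]
        map_smul' := fun r b => by rw [smul_tmul, map_smul, LinearMap.smul_apply]; rfl }
    have hf : (LinearMap.ker f).CoFG := by
      have : FiniteDimensional ℂ (LinearMap.range f) :=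
        Submodule.finiteDimensional_of_le (S₂ := LinearMap.range (α (tmul p' c d))) (by
          rintro _ ⟨b, rfl⟩
          refine ⟨f b, ?_⟩
          change α (tmul p' c d) (α (tmul p' c b) w) = α (tmul p' c b) w
          rw [h.hom_tmul_hom_tmul, hcd, one_smul])
      exact Submodule.range_fg_iff_ker_cofg.1 (Module.Finite.iff_fg.1 this)
    have hg : (LinearMap.ker g).CoFG := by
      have : FiniteDimensional ℂ (LinearMap.range g) :=
        Submodule.finiteDimensional_of_le (S₂ := LinearMap.range (β (tmul p' c d))) (by
          rintro _ ⟨b, rfl⟩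
          refine ⟨g b, ?_⟩
          change β (tmul p' c d) (β (tmul p' b d) w) = β (tmul p' b d) w
          rw [h.anti_tmul_anti_tmul, hcd, one_smul])
      exact Submodule.range_fg_iff_ker_cofg.1 (Module.Finite.iff_fg.1 this)
    refine ⟨A ⊓ LinearMap.ker g, B ⊓ LinearMap.ker f, hA.inf hg, hB.inf hf, ?_⟩
    intro a ha b hb v hv
    rcases Finset.mem_insert.1 hv with rfl | hv
    · have h1 : α (tmul p' c b) v = 0 := hb.2
      have h2 : β (tmul p' a d) v = 0 := ha.2
      have h3 := h.hom_tmul_hom_tmul a c d b v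
      have h4 := h.anti_tmul_anti_tmul c a b d v
      rw [hcd, one_smul] at h3 h4
      rw [← h3, ← h4, h1, h2, map_zero, map_zero]
      exact ⟨rfl, rfl⟩
    · exact hAB a ha.1 b hb.1 v hv

end IsSplitPair

/-- Subspaces of finite codimension are not orthogonal. -/
theorem exists_pairing_eq_one_of_cofg (hp' : IsCountablePairing p') {A : Submodule ℂ V'}
    {B : Submodule ℂ W'} (hA : A.CoFG) (hB : B.CoFG) : ∃ a ∈ A, ∃ b ∈ B, p' a b = 1 := by
  suffices hne : ∃ a ∈ A, ∃ b ∈ B, p' a b ≠ 0 by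
    obtain ⟨a, ha, b, hb, hab⟩ := hne
    exact ⟨a, ha, (p' a b)⁻¹ • b, B.smul_mem _ hb, by simp [hab]⟩
  by_contra! h0
  have hfin : FiniteDimensional ℂ (LinearMap.range B.mkQ.dualMap) := inferInstance
  -- If A and B were orthogonal, p' would embed A in the annihilator of B, the dual of a
  -- finite-dimensional quotient; then A, and with it V', would be finite-dimensional.
  have hle : A.map p' ≤ LinearMap.range B.mkQ.dualMap := by
    rw [LinearMap.range_dualMap_eq_dualAnnihilator_ker, Submodule.ker_mkQ]
    rintro _ ⟨a, ha, rfl⟩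
    exact (Submodule.mem_dualAnnihilator _).2 fun b hb => h0 a ha b hb
  have hfinA : FiniteDimensional ℂ (A.map p') := Submodule.finiteDimensional_of_le hle
  have hinj : Function.Injective p' := by
    rw [injective_iff_map_eq_zero]
    exact fun a ha => hp'.nondegenerate.1 a fun b => by rw [ha, LinearMap.zero_apply]
  have hA' : Module.Finite ℂ A :=
    Module.Finite.equiv (Submodule.equivMapOfInjective p' hinj A).symm
  have hAq : Module.Finite ℂ (V' ⧸ A) := hA
  exact hp'.not_finite_left (Module.Finite.of_submodule_quotient A)

end Socle

/-! ### Natural and conatural modules along a split pair -/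

section NatConat

variable {V' W' V W : Type*} [AddCommGroup V'] [Module ℂ V'] [AddCommGroup W'] [Module ℂ W']
  [AddCommGroup V] [Module ℂ V] [AddCommGroup W] [Module ℂ W]
  {p' : V' →ₗ[ℂ] W' →ₗ[ℂ] ℂ} {p : V →ₗ[ℂ] W →ₗ[ℂ] ℂ}

/-- The kernel of g is the annihilator of the range of f, so the range of g embeds in the dual of
the range of f. Applied in both directions, this matches the multiplicities on V with those on V_*.
-/
theorem finrank_range_le_of_adjoint {p : V →ₗ[ℂ] W →ₗ[ℂ] ℂ} (hp : p.SeparatingRight)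
    {f : Module.End ℂ V} {g : Module.End ℂ W} (hfg : ∀ x y, p (f x) y = p x (g y))
    (hf : FiniteDimensional ℂ (LinearMap.range f)) :
    Module.finrank ℂ (LinearMap.range g) ≤ Module.finrank ℂ (LinearMap.range f) := by
  let T : W →ₗ[ℂ] Module.Dual ℂ (LinearMap.range f) :=
    (LinearMap.range f).subtype.dualMap ∘ₗ p.flip
  have hker : LinearMap.ker T ≤ LinearMap.ker g := by
    intro y hy
    refine hp _ fun x => ?_
    rw [← hfg]
    exact LinearMap.congr_fun hy (⟨f x, x, rfl⟩ : LinearMap.range f)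
  have hker' : LinearMap.ker g ≤ LinearMap.ker T := by
    intro y hy
    refine LinearMap.ext ?_
    rintro ⟨_, x, rfl⟩
    change p (f x) y = 0
    rw [hfg, hy, map_zero]
  have he : LinearMap.ker g = LinearMap.ker T := le_antisymm hker' hker
  rw [← (g.quotKerEquivRange).finrank_eq, he, T.quotKerEquivRange.finrank_eq,
    ← Subspace.dual_finrank_eq (K := ℂ) (V := LinearMap.range f)]
  exact Submodule.finrank_le _

theorem finrank_range_natAct (hp : p.Nondegenerate) (a : Gl p) :
    Module.finrank ℂ (LinearMap.range (natAct p a)) =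
      Module.finrank ℂ (LinearMap.range (conatAct p a)) := by
  have h1 : ∀ (x : V) (y : W), p (natAct₀ p a x) y = p x ((-conatAct₀ p a) y) := fun x y => by
    refine (pairing_natAct a x y).trans ?_
    rw [LinearMap.neg_apply, map_neg]
    rfl
  have hr : LinearMap.range (-conatAct₀ p a) = LinearMap.range (conatAct₀ p a) :=
    LinearMap.range_neg _
  have hf2 : FiniteDimensional ℂ (LinearMap.range (-conatAct₀ p a)) := by
    rw [hr]; exact finiteDimensional_range_conatAct a
  refine le_antisymm ?_ ?_
  · have := finrank_range_le_of_adjoint (p := p.flip) (LinearMap.flip_separatingRight.2 hp.1)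
      (fun x y => (h1 y x).symm) hf2
    rwa [hr] at this
  · have := finrank_range_le_of_adjoint hp.2 h1 (finiteDimensional_range_natAct a)
    rwa [hr] at this

theorem IsSplitPair.nat {α β : Gl p' →ₗ[ℂ] Gl p} (h : IsSplitPair (glMul p) p' α β) :
    IsSplitPair (LinearMap.mul ℂ (Module.End ℂ (Natl p))) p' (natAct p ∘ₗ α)
      (natAct p ∘ₗ β) where
  map_mul x y := by
    rw [LinearMap.comp_apply, h.map_mul, natAct_glMul]; rfl
  map_mul_rev x y := by
    rw [LinearMap.comp_apply, h.map_mul_rev, natAct_glMul]; rfl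
  mul_eq_zero x y := by
    rw [LinearMap.comp_apply, LinearMap.comp_apply, LinearMap.mul_apply', ← natAct_glMul,
      h.mul_eq_zero, map_zero]
  mul_eq_zero' x y := by
    rw [LinearMap.comp_apply, LinearMap.comp_apply, LinearMap.mul_apply', ← natAct_glMul,
      h.mul_eq_zero', map_zero]

/-- The negated conatural action reverses products, so β yields the homomorphism and α the
antihomomorphism. This is why k and l trade places on V_*. -/
theorem IsSplitPair.conat {α β : Gl p' →ₗ[ℂ] Gl p} (h : IsSplitPair (glMul p) p' α β) :
    IsSplitPair (LinearMap.mul ℂ (Module.End ℂ (Conatl p))) p' (-(conatAct p ∘ₗ β))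
      (-(conatAct p ∘ₗ α)) where
  map_mul x y := by
    simp only [LinearMap.neg_apply, LinearMap.comp_apply, LinearMap.mul_apply', neg_mul_neg,
      h.map_mul_rev, conatAct_glMul, neg_neg]
  map_mul_rev x y := by
    simp only [LinearMap.neg_apply, LinearMap.comp_apply, LinearMap.mul_apply', neg_mul_neg,
      h.map_mul, conatAct_glMul, neg_neg]
  mul_eq_zero x y := by
    simp only [LinearMap.neg_apply, LinearMap.comp_apply, LinearMap.mul_apply', neg_mul_neg]
    rw [← neg_neg (conatAct p (β x) * _), ← conatAct_glMul, h.mul_eq_zero, map_zero, neg_zero]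
  mul_eq_zero' x y := by
    simp only [LinearMap.neg_apply, LinearMap.comp_apply, LinearMap.mul_apply', neg_mul_neg]
    rw [← neg_neg (conatAct p (α x) * _), ← conatAct_glMul, h.mul_eq_zero', map_zero, neg_zero]

theorem IsSplitPair.id (p : V →ₗ[ℂ] W →ₗ[ℂ] ℂ) : IsSplitPair (glMul p) p LinearMap.id 0 where
  map_mul _ _ := rfl
  map_mul_rev _ _ := by simp
  mul_eq_zero _ _ := by simp
  mul_eq_zero' _ _ := by simp

theorem finiteDimensional_range_neg_conatAct (a : Gl p) :
    FiniteDimensional ℂ (LinearMap.range (-conatAct p a)) := by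
  rw [LinearMap.range_neg]; exact finiteDimensional_range_conatAct a

/-- Finitely many natural and conatural vectors are annihilated by an element of trace one. -/
theorem IsSplitPair.exists_glTrace_eq_one {α β : Gl p' →ₗ[ℂ] Gl p}
    (h : IsSplitPair (glMul p) p' α β) (hp' : IsCountablePairing p') (S : Finset (Natl p))
    (T : Finset (Conatl p)) : ∃ y : Gl p', glTrace p' y = 1 ∧
      (∀ v ∈ S, natAct p (α y - β y) v = 0) ∧ ∀ w ∈ T, conatAct p (α y - β y) w = 0 := by
  obtain ⟨c, d, hcd⟩ := hp'.exists_eq_one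
  obtain ⟨A, B, hA, hB, h1⟩ := h.nat.exists_cofg hcd (finiteDimensional_range_natAct _)
    (finiteDimensional_range_natAct _) S
  obtain ⟨A', B', hA', hB', h2⟩ := h.conat.exists_cofg hcd
    (finiteDimensional_range_neg_conatAct _) (finiteDimensional_range_neg_conatAct _) T
  obtain ⟨a, ha, b, hb, hab⟩ := exists_pairing_eq_one_of_cofg hp' (hA.inf hA') (hB.inf hB')
  refine ⟨tmul p' a b, (glTrace_tmul a b).trans hab, fun v hv => ?_, fun w hw => ?_⟩
  · obtain ⟨e1, e2⟩ := h1 a ha.1 b hb.1 v hv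
    rw [LinearMap.comp_apply] at e1 e2
    rw [map_sub, LinearMap.sub_apply, e1, e2, sub_zero]
  · obtain ⟨e1, e2⟩ := h2 a ha.2 b hb.2 w hw
    rw [LinearMap.neg_apply, LinearMap.comp_apply, LinearMap.neg_apply, neg_eq_zero] at e1 e2
    rw [map_sub, LinearMap.sub_apply, e1, e2, sub_zero]

/-- If both ranks were zero, the faithful natural action would give α = β = 0 at c ⊗ d, an element
of trace one in the kernel. -/
theorem IsSplitPair.finrank_pos {α β : Gl p' →ₗ[ℂ] Gl p} (h : IsSplitPair (glMul p) p' α β)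
    (hp : p.SeparatingRight) (hinj : Function.Injective h.lieHom) {c : V'} {d : W'}
    (hcd : p' c d = 1) :
    0 < Module.finrank ℂ (LinearMap.range (natAct p (α (tmul p' c d)))) ∨
      0 < Module.finrank ℂ (LinearMap.range (natAct p (β (tmul p' c d)))) := by
  by_contra! hc
  have key : ∀ a : Gl p, Module.finrank ℂ (LinearMap.range (natAct p a)) ≤ 0 → a = 0 := by
    intro a ha
    have := finiteDimensional_range_natAct a
    have h0 := Submodule.finrank_eq_zero.1 (Nat.le_zero.1 ha)
    exact natAct_injective hp (by rw [LinearMap.range_eq_bot.1 h0, map_zero])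
  have h0 : h.lieHom (tmul p' c d) = 0 := by
    rw [h.lieHom_apply, key _ hc.1, key _ hc.2, sub_zero]
  have h1 := (injective_iff_map_eq_zero h.lieHom).1 hinj _ h0
  have h2 := glTrace_tmul (p := p') c d
  rw [h1, map_zero, hcd] at h2
  exact zero_ne_one h2

theorem IsSplitPair.isGeneralTensorType {α β : Gl p' →ₗ[ℂ] Gl p}
    (h : IsSplitPair (glMul p) p' α β) (hp' : IsCountablePairing p') (hp : IsCountablePairing p)
    (hinj : Function.Injective h.lieHom) :
    IsGeneralTensorType h.lieHom (Natl p) (Conatl p) (Natl p') (Conatl p') := by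
  obtain ⟨c, d, hcd⟩ := hp'.exists_eq_one
  refine ⟨_, _, h.finrank_pos hp.nondegenerate.2 hinj hcd, ?_, ?_⟩
  · refine IsSplitPair.hasTensorSocle (W := Res h.lieHom (Natl p)) h.nat (fun x w => ?_)
      hp'.nondegenerate hcd (finiteDimensional_range_natAct _) (finiteDimensional_range_natAct _)
      hp.rank_left.le
    exact LinearMap.congr_fun (map_sub (natAct p) (α x) (β x)) w
  · have h1 : ∀ x, LinearMap.range ((-(conatAct p ∘ₗ x : Gl p' →ₗ[ℂ] _)) (tmul p' c d)) =
        LinearMap.range (conatAct p (x (tmul p' c d))) := fun x => LinearMap.range_neg _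
    rw [finrank_range_natAct hp.nondegenerate, finrank_range_natAct hp.nondegenerate, ← h1,
      ← h1]
    refine IsSplitPair.hasTensorSocle (W := Res h.lieHom (Conatl p)) h.conat (fun x w => ?_)
      hp'.nondegenerate hcd (finiteDimensional_range_neg_conatAct _)
      (finiteDimensional_range_neg_conatAct _) hp.rank_right.le
    have e : conatAct p (α x - β x) = -conatAct p (β x) - -conatAct p (α x) := by
      rw [map_sub]; abel
    exact LinearMap.congr_fun e w

end NatConat

/-! ### Modules determined by finitely many vectors -/

section Determined

variable {L V W M N : Type*} [LieRing L] [LieAlgebra ℂ L]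
  [AddCommGroup V] [LieRingModule L V] [AddCommGroup W] [LieRingModule L W]
  [AddCommGroup M] [Module ℂ M] [LieRingModule L M] [LieModule ℂ L M]
  [AddCommGroup N] [Module ℂ N] [LieRingModule L N] [LieModule ℂ L N]

variable (L V W) in
/-- The vector `m` is annihilated by every element of `L` which annihilates certain finite sets of
vectors of `V` and of `W`. -/
def IsDetermined (m : M) : Prop :=
  ∃ (S : Finset V) (T : Finset W), ∀ x : L, (∀ v ∈ S, ⁅x, v⁆ = 0) → (∀ w ∈ T, ⁅x, w⁆ = 0) →
    ⁅x, m⁆ = 0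

namespace IsDetermined

theorem zero : IsDetermined L V W (0 : M) := ⟨∅, ∅, fun _ _ _ => lie_zero _⟩

theorem add {m n : M} (hm : IsDetermined L V W m) (hn : IsDetermined L V W n) :
    IsDetermined L V W (m + n) := by
  classical
  obtain ⟨S, T, h⟩ := hm
  obtain ⟨S', T', h'⟩ := hn
  refine ⟨S ∪ S', T ∪ T', fun x hS hT => ?_⟩
  rw [lie_add, h x (fun v hv => hS v (Finset.mem_union_left _ hv))
    fun w hw => hT w (Finset.mem_union_left _ hw),
    h' x (fun v hv => hS v (Finset.mem_union_right _ hv))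
    fun w hw => hT w (Finset.mem_union_right _ hw), add_zero]

theorem smul (c : ℂ) {m : M} (hm : IsDetermined L V W m) : IsDetermined L V W (c • m) := by
  obtain ⟨S, T, h⟩ := hm
  exact ⟨S, T, fun x hS hT => by rw [lie_smul, h x hS hT, smul_zero]⟩

theorem map (f : M →ₗ⁅ℂ,L⁆ N) {m : M} (hm : IsDetermined L V W m) :
    IsDetermined L V W (f m) := by
  obtain ⟨S, T, h⟩ := hm
  exact ⟨S, T, fun x hS hT => by rw [← LieModuleHom.map_lie, h x hS hT, map_zero]⟩

theorem of_map (f : M →ₗ⁅ℂ,L⁆ N) (hf : Function.Injective f) {m : M}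
    (hm : IsDetermined L V W (f m)) : IsDetermined L V W m := by
  obtain ⟨S, T, h⟩ := hm
  exact ⟨S, T, fun x hS hT => hf (by rw [LieModuleHom.map_lie, h x hS hT, map_zero])⟩

theorem directSum {ι : Type*} {X : ι → Type*} [∀ i, AddCommGroup (X i)] [∀ i, Module ℂ (X i)]
    [∀ i, LieRingModule L (X i)] [∀ i, LieModule ℂ L (X i)]
    (h : ∀ i (m : X i), IsDetermined L V W m) (m : ⨁ i, X i) : IsDetermined L V W m := by
  classical
  induction m using DirectSum.induction_on with
  | zero => exact zero
  | of i x => exact (h i x).map (DirectSum.lieModuleOf ℂ ι L X i)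
  | add x y hx hy => exact hx.add hy

theorem tensor (hM : ∀ m : M, IsDetermined L V W m) (hN : ∀ n : N, IsDetermined L V W n)
    (t : M ⊗[ℂ] N) : IsDetermined L V W t := by
  classical
  induction t with
  | zero => exact zero
  | add x y hx hy => exact hx.add hy
  | tmul m n =>
    obtain ⟨S, T, h⟩ := hM m
    obtain ⟨S', T', h'⟩ := hN n
    refine ⟨S ∪ S', T ∪ T', fun x hS hT => ?_⟩
    rw [TensorProduct.LieModule.lie_tmul_right, h x (fun v hv => hS v (Finset.mem_union_left _ hv))
      fun w hw => hT w (Finset.mem_union_left _ hw),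
      h' x (fun v hv => hS v (Finset.mem_union_right _ hv))
      fun w hw => hT w (Finset.mem_union_right _ hw), TensorProduct.zero_tmul,
      TensorProduct.tmul_zero, add_zero]

theorem tpow (hM : ∀ m : M, IsDetermined L V W m) (n : ℕ) (t : TPow M n) :
    IsDetermined L V W t := by
  classical
  refine PiTensorProduct.induction_on (motive := IsDetermined (M := TPow M n) L V W) t
    (fun r f => ?_) fun x y hx hy => hx.add hy
  have key : IsDetermined (M := TPow M n) L V W (PiTensorProduct.tprod ℂ f) := by
    choose S T h using fun i => hM (f i)
    refine ⟨Finset.univ.biUnion S, Finset.univ.biUnion T, fun x hS hT => ?_⟩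
    refine (tpowAct_tprod n (LieModule.toEnd ℂ L M x) f).trans (Finset.sum_eq_zero fun i _ => ?_)
    have h0 : LieModule.toEnd ℂ L M x (f i) = 0 :=
      h i x (fun v hv => hS v (Finset.mem_biUnion.2 ⟨i, Finset.mem_univ i, hv⟩))
        fun w hw => hT w (Finset.mem_biUnion.2 ⟨i, Finset.mem_univ i, hw⟩)
    rw [h0]
    exact (PiTensorProduct.tprod ℂ).map_update_zero f i
  exact key.smul r

theorem left [Module ℂ V] [LieModule ℂ L V] (v : V) : IsDetermined L V W v :=
  ⟨{v}, ∅, fun _ h _ => h v (Finset.mem_singleton_self v)⟩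

theorem right [Module ℂ W] [LieModule ℂ L W] (w : W) : IsDetermined L V W w :=
  ⟨∅, {w}, fun _ _ h => h w (Finset.mem_singleton_self w)⟩

/-- Determination by finitely many vectors passes to direct sums, submodules and homomorphic images.
-/
theorem of_isSubquotientOfCopies {X : Type*} [AddCommGroup X] [Module ℂ X] [LieRingModule L X]
    [LieModule ℂ L X] (hX : ∀ x : X, IsDetermined L V W x) (h : IsSubquotientOfCopies L X M)
    (m : M) : IsDetermined L V W m := by
  obtain ⟨k, Y, f, hf⟩ := h
  obtain ⟨y, rfl⟩ := hf m
  exact map f (of_map Y.incl Y.injective_incl (directSum (fun _ x => hX x) _))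

end IsDetermined

variable [Module ℂ V] [LieModule ℂ L V] [Module ℂ W] [LieModule ℂ L W]

theorem IsMixedTensorModule.isDetermined (h : IsMixedTensorModule L V W M) (m : M) :
    IsDetermined L V W m := by
  obtain ⟨r, h⟩ := h
  exact IsDetermined.of_isSubquotientOfCopies (IsDetermined.directSum fun i =>
    IsDetermined.tensor (IsDetermined.tpow IsDetermined.left _)
      (IsDetermined.tpow IsDetermined.right _)) h m

theorem IsPureTensorModule.isDetermined (h : IsPureTensorModule L V M) (m : M) :
    IsDetermined L V W m := by
  obtain ⟨r, h⟩ := h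
  exact IsDetermined.of_isSubquotientOfCopies (IsDetermined.directSum fun i =>
    IsDetermined.tpow IsDetermined.left _) h m

end Determined

/-! ### Comparison of socle filtrations -/

section SocleFiltration

section

variable {L M : Type*} [LieRing L] [LieAlgebra ℂ L]
  [AddCommGroup M] [Module ℂ M] [LieRingModule L M] [LieModule ℂ L M]

theorem comap_mk'_map_mk' {N Q : LieSubmodule ℂ L M} (h : N ≤ Q) :
    (Q.map (LieSubmodule.Quotient.mk' N)).comap (LieSubmodule.Quotient.mk' N) = Q := by
  refine le_antisymm (fun x hx => ?_) (LieSubmodule.map_le_iff_le_comap.1 le_rfl)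
  obtain ⟨y, hy, hxy⟩ := (LieSubmodule.mem_map _).1 (LieSubmodule.mem_comap.1 hx)
  have : x - y ∈ N := by
    rw [← LieSubmodule.Quotient.mk_eq_zero, map_sub, hxy, sub_self]
  have h2 := Q.add_mem (h this) hy
  rwa [sub_add_cancel] at h2

theorem map_mk'_comap_mk' {N : LieSubmodule ℂ L M} (A : LieSubmodule ℂ L (M ⧸ N)) :
    (A.comap (LieSubmodule.Quotient.mk' N)).map (LieSubmodule.Quotient.mk' N) = A := by
  refine le_antisymm (LieSubmodule.map_le_iff_le_comap.2 le_rfl) fun a ha => ?_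
  obtain ⟨x, rfl⟩ := LieSubmodule.Quotient.surjective_mk' N a
  exact (LieSubmodule.mem_map _).2 ⟨x, ha, rfl⟩

theorem le_comap_mk' {N : LieSubmodule ℂ L M} (A : LieSubmodule ℂ L (M ⧸ N)) :
    N ≤ A.comap (LieSubmodule.Quotient.mk' N) := by
  intro x hx
  rw [LieSubmodule.mem_comap, (LieSubmodule.Quotient.mk_eq_zero N).2 hx]
  exact A.zero_mem

/-- Submodules of `M ⧸ N` correspond to submodules of `M` containing `N`. -/
def quotientOrderIso (N : LieSubmodule ℂ L M) : LieSubmodule ℂ L (M ⧸ N) ≃o Set.Ici N where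
  toFun A := ⟨A.comap (LieSubmodule.Quotient.mk' N), le_comap_mk' A⟩
  invFun Q := Q.1.map (LieSubmodule.Quotient.mk' N)
  left_inv A := map_mk'_comap_mk' A
  right_inv Q := Subtype.ext (comap_mk'_map_mk' Q.2)
  map_rel_iff' {A B} := by
    refine ⟨fun h => ?_, fun h x hx => h hx⟩
    rw [← map_mk'_comap_mk' A, ← map_mk'_comap_mk' B]
    exact LieSubmodule.map_mono h

/-- Simple submodules of M ⧸ N correspond to covers of N. In this form the filtration uses only the
lattice of submodules, so an isomorphism of lattices transports it. -/
theorem socFiltration_succ (r : ℕ) :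
    socFiltration L M (r + 1) =
      socFiltration L M r ⊔ sSup {P | socFiltration L M r ⋖ P} := by
  set N := socFiltration L M r
  change (socle L (M ⧸ N)).comap (LieSubmodule.Quotient.mk' N) = _
  refine le_antisymm ?_ (sup_le (le_comap_mk' _) (sSup_le fun P hP => ?_))
  · set Q := N ⊔ sSup {P | N ⋖ P}
    rw [← comap_mk'_map_mk' (N := N) (Q := Q) le_sup_left]
    have hle : socle L (M ⧸ N) ≤ Q.map (LieSubmodule.Quotient.mk' N) := by
      refine sSup_le fun A hA => ?_
      rw [← map_mk'_comap_mk' A]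
      refine LieSubmodule.map_mono (le_sup_of_le_right (le_sSup ?_))
      exact Set.Ici.isAtom_iff.1 (((quotientOrderIso N).isAtom_iff A).2 hA)
    exact fun x hx => hle hx
  · refine LieSubmodule.map_le_iff_le_comap.1 (le_sSup ?_)
    exact ((quotientOrderIso N).symm.isAtom_iff ⟨P, hP.le⟩).2 (Set.Ici.isAtom_iff.2 hP)

end

variable {L L' M : Type*} [LieRing L] [LieAlgebra ℂ L] [LieRing L'] [LieAlgebra ℂ L']
  [AddCommGroup M] [Module ℂ M] [LieRingModule L M] [LieModule ℂ L M] [LieRingModule L' M]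
  [LieModule ℂ L' M]

/-- If two Lie algebras acting on `M` have the same orbits, every submodule over one of them is a
submodule over the other. -/
def submoduleOfOrbits (h : ∀ (y : L') (m : M), ∃ x : L, ⁅y, m⁆ = ⁅x, m⁆)
    (N : LieSubmodule ℂ L M) : LieSubmodule ℂ L' M :=
  { N.toSubmodule with
    lie_mem := by
      intro y m hm
      obtain ⟨x, hx⟩ := h y m
      rw [hx]
      exact N.lie_mem hm }

/-- The isomorphism of lattices of submodules over two Lie algebras with the same orbits. -/
def orbitsOrderIso (h : ∀ (y : L') (m : M), ∃ x : L, ⁅y, m⁆ = ⁅x, m⁆)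
    (h' : ∀ (x : L) (m : M), ∃ y : L', ⁅x, m⁆ = ⁅y, m⁆) :
    LieSubmodule ℂ L M ≃o LieSubmodule ℂ L' M where
  toFun := submoduleOfOrbits h
  invFun := submoduleOfOrbits h'
  left_inv _ := rfl
  right_inv _ := rfl
  map_rel_iff' := Iff.rfl

theorem orbitsOrderIso_socFiltration (h : ∀ (y : L') (m : M), ∃ x : L, ⁅y, m⁆ = ⁅x, m⁆)
    (h' : ∀ (x : L) (m : M), ∃ y : L', ⁅x, m⁆ = ⁅y, m⁆) (r : ℕ) :
    orbitsOrderIso h h' (socFiltration L M r) = socFiltration L' M r := by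
  induction r with
  | zero => exact (orbitsOrderIso h h').map_bot
  | succ r ih =>
    rw [socFiltration_succ, socFiltration_succ, map_sup, ih, OrderIso.map_sSup_eq_sSup_symm_preimage]
    congr 2
    ext P
    rw [Set.mem_preimage, Set.mem_ofPred_eq, Set.mem_ofPred_eq, ← ih,
      ← apply_covBy_apply_iff (orbitsOrderIso h h'), OrderIso.apply_symm_apply]

theorem socFiltration_toSubmodule_eq (h : ∀ (y : L') (m : M), ∃ x : L, ⁅y, m⁆ = ⁅x, m⁆)
    (h' : ∀ (x : L) (m : M), ∃ y : L', ⁅x, m⁆ = ⁅y, m⁆) (r : ℕ) :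
    (socFiltration L M r).toSubmodule = (socFiltration L' M r).toSubmodule := by
  rw [← orbitsOrderIso_socFiltration h h']
  rfl

end SocleFiltration

/-! ### Extension of tensor modules from `sl` to `gl` -/

section Extension

section

variable {V' W' : Type*} [AddCommGroup V'] [Module ℂ V'] [AddCommGroup W'] [Module ℂ W']
  {p' : V' →ₗ[ℂ] W' →ₗ[ℂ] ℂ}

/-- The element `x - tr(x) t` of `sl`, for an element `t` of trace one. -/
def slSub (x : Gl p') {t : Gl p'} (ht : glTrace p' t = 1) : Sl p' :=
  ⟨x - glTrace p' x • t, by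
    by_cases hx : ∃ c d, p' c d = 1
    · obtain ⟨c, d, hcd⟩ := hx
      have := sub_glTrace_mem hcd (x - glTrace p' x • t)
      rwa [map_sub, map_smul, ht, smul_eq_mul, mul_one, sub_self, zero_smul, sub_zero] at this
    -- With no pair of pairing one, p' is zero, and then so is the trace, contrary to the existence
    -- of t.
    · exfalso
      have h0 : p' = 0 := by
        ext v w
        by_contra hvw
        exact hx ⟨v, (p' v w)⁻¹ • w, by
          rw [map_smul, smul_eq_mul]; exact inv_mul_cancel₀ hvw⟩
      have h1 : glTrace p' = 0 := by
        rw [glTrace, h0]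
        exact TensorProduct.ext' fun v w => rfl
      rw [h1] at ht
      exact zero_ne_one ht⟩

theorem coe_slSub (x : Gl p') {t : Gl p'} (ht : glTrace p' t = 1) :
    (slSub x ht : Gl p') = x - glTrace p' x • t := rfl

theorem lie_slSub {M : Type*} [AddCommGroup M] [Module ℂ M] [LieRingModule (Gl p') M]
    [LieModule ℂ (Gl p') M] (x : Gl p') {t : Gl p'} (ht : glTrace p' t = 1) {m : M}
    (hm : ⁅t, m⁆ = 0) : ⁅(slSub x ht : Gl p'), m⁆ = ⁅x, m⁆ := by
  rw [coe_slSub, sub_lie, smul_lie, hm, smul_zero, sub_zero]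

/-- On m, x acts as the element x - tr(x) t of sl, so the orbits over sl and gl coincide. The
targets L₁ and L₂ differ because for 𝔤 = sl the first acts by sl(V, V_*) and the second by
endomorphisms of M. -/
theorem socAlong_eq {L₁ L₂ M : Type*} [LieRing L₁] [LieAlgebra ℂ L₁] [LieRing L₂]
    [LieAlgebra ℂ L₂] [AddCommGroup M] [Module ℂ M] [LieRingModule L₁ M] [LieModule ℂ L₁ M]
    [LieRingModule L₂ M] [LieModule ℂ L₂ M] {φ : Sl p' →ₗ⁅ℂ⁆ L₁} {ψ : Gl p' →ₗ⁅ℂ⁆ L₂}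
    (hφψ : ∀ (x : Sl p') (m : M), ⁅φ x, m⁆ = ⁅ψ x, m⁆)
    (hdet : ∀ m : M, ∃ t, glTrace p' t = 1 ∧ ⁅ψ t, m⁆ = 0) (r : ℕ) :
    socAlong φ M r = socAlong ψ M r := by
  let : LieRingModule (Sl p') M := inferInstanceAs (LieRingModule (Sl p') (Res φ M))
  have : LieModule ℂ (Sl p') M := inferInstanceAs (LieModule ℂ (Sl p') (Res φ M))
  let : LieRingModule (Gl p') M := inferInstanceAs (LieRingModule (Gl p') (Res ψ M))
  have : LieModule ℂ (Gl p') M := inferInstanceAs (LieModule ℂ (Gl p') (Res ψ M))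
  refine socFiltration_toSubmodule_eq (L := Sl p') (L' := Gl p') (M := M) (fun x m => ?_)
    (fun x m => ⟨x, hφψ x m⟩) r
  obtain ⟨t, ht, htm⟩ := hdet m
  exact ⟨slSub x ht, (lie_slSub x ht (m := m) htm).symm.trans (hφψ _ m).symm⟩

end

/-- M has no action of L beforehand; the action on N descends because the kernel of f is stable. -/
theorem exists_lieHom_of_surjective {L N M : Type*} [LieRing L] [LieAlgebra ℂ L]
    [AddCommGroup N] [Module ℂ N] [LieRingModule L N] [LieModule ℂ L N] [AddCommGroup M]
    [Module ℂ M] (f : N →ₗ[ℂ] M) (hf : Function.Surjective f)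
    (hker : ∀ (x : L) (n : N), f n = 0 → f ⁅x, n⁆ = 0) :
    ∃ ρ : L →ₗ⁅ℂ⁆ Module.End ℂ M, ∀ (x : L) (n : N), ρ x (f n) = f ⁅x, n⁆ := by
  let act : L → M → M := fun x m => f ⁅x, Function.surjInv hf m⁆
  have hact : ∀ x n, act x (f n) = f ⁅x, n⁆ := by
    intro x n
    have h1 : f (Function.surjInv hf (f n) - n) = 0 := by
      rw [map_sub, Function.surjInv_eq hf, sub_self]
    have h2 := hker x _ h1
    rwa [lie_sub, map_sub, sub_eq_zero] at h2
  let ρ₀ : L → Module.End ℂ M := fun x =>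
    { toFun := act x
      map_add' := fun a b => by
        obtain ⟨a, rfl⟩ := hf a
        obtain ⟨b, rfl⟩ := hf b
        rw [← map_add, hact, hact, hact, lie_add, map_add]
      map_smul' := fun c a => by
        obtain ⟨a, rfl⟩ := hf a
        rw [← map_smul, hact, hact, lie_smul, map_smul, RingHom.id_apply] }
  have hρ₀ : ∀ x n, ρ₀ x (f n) = f ⁅x, n⁆ := hact
  refine ⟨{ toFun := ρ₀, map_add' := fun x y => ?_, map_smul' := fun c x => ?_,
            map_lie' := fun {x y} => ?_ }, hact⟩
  · refine LinearMap.ext fun m => ?_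
    obtain ⟨n, rfl⟩ := hf m
    rw [LinearMap.add_apply, hρ₀, hρ₀, hρ₀, add_lie, map_add]
  · refine LinearMap.ext fun m => ?_
    obtain ⟨n, rfl⟩ := hf m
    rw [RingHom.id_apply, LinearMap.smul_apply, hρ₀, hρ₀, smul_lie, map_smul]
  · change ρ₀ ⁅x, y⁆ = ⁅ρ₀ x, ρ₀ y⁆
    refine LinearMap.ext fun m => ?_
    obtain ⟨n, rfl⟩ := hf m
    rw [LieRing.of_associative_ring_bracket, LinearMap.sub_apply, Module.End.mul_apply,
      Module.End.mul_apply, hρ₀, hρ₀, hρ₀, hρ₀, hρ₀, lie_lie, map_sub]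

variable {V W : Type*} [AddCommGroup V] [Module ℂ V] [AddCommGroup W] [Module ℂ W]
  {p : V →ₗ[ℂ] W →ₗ[ℂ] ℂ}

theorem exists_glTrace_eq_one (hp : IsCountablePairing p) (S : Finset (Natl p))
    (T : Finset (Conatl p)) : ∃ t : Gl p, glTrace p t = 1 ∧
      (∀ v ∈ S, ⁅t, v⁆ = 0) ∧ ∀ w ∈ T, ⁅t, w⁆ = 0 := by
  obtain ⟨t, ht, h1, h2⟩ := (IsSplitPair.id p).exists_glTrace_eq_one hp S T
  rw [LinearMap.zero_apply, sub_zero] at h1 h2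
  exact ⟨t, ht, h1, h2⟩

theorem IsDetermined.exists_glTrace_eq_one (hp : IsCountablePairing p) {M : Type*}
    [AddCommGroup M] [LieRingModule (Gl p) M] {m : M}
    (hm : IsDetermined (Gl p) (Natl p) (Conatl p) m) :
    ∃ t : Gl p, glTrace p t = 1 ∧ ⁅t, m⁆ = 0 := by
  obtain ⟨S, T, h⟩ := hm
  obtain ⟨t, ht, h1, h2⟩ := LocFin.exists_glTrace_eq_one hp S T
  exact ⟨t, ht, h t h1 h2⟩

/-- The ambient sum of mixed tensors is already a gl-module in which each vector is annihilated by
an element of trace one. Its sl-submodules, in particular N and the kernel of f, are therefore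
stable under gl, and the action descends to M. -/
theorem exists_extension (hp : IsCountablePairing p) {M : Type*} [AddCommGroup M] [Module ℂ M]
    [LieRingModule (Sl p) M] [LieModule ℂ (Sl p) M]
    (hM : IsMixedTensorModule (Sl p) (Natl p) (Conatl p) M) :
    ∃ ρ : Gl p →ₗ⁅ℂ⁆ Module.End ℂ M, (∀ (x : Sl p) (m : M), ρ x m = ⁅x, m⁆) ∧
      IsMixedTensorModule (Gl p) (Natl p) (Conatl p) (Res ρ M) := by
  obtain ⟨r, k, N, f, hf⟩ := hM
  let X := ⨁ i : {i : ℕ × ℕ // i.1 + i.2 ≤ r},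
    (TPow (Natl p) i.1.1 ⊗[ℂ] TPow (Conatl p) i.1.2)
  let Y := ⨁ _ : Fin k, X
  have hY : ∀ (h : Sl p) (y : Y), ⁅h, y⁆ = ⁅(h : Gl p), y⁆ := fun h y => rfl
  have hdet : ∀ y : Y, IsDetermined (Gl p) (Natl p) (Conatl p) y :=
    IsDetermined.directSum fun _ => IsDetermined.directSum fun i =>
      IsDetermined.tensor (IsDetermined.tpow IsDetermined.left _)
        (IsDetermined.tpow IsDetermined.right _)
  have horb : ∀ (x : Gl p) (y : Y), ∃ h : Sl p, ⁅x, y⁆ = ⁅h, y⁆ := fun x y => by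
    obtain ⟨t, ht, hty⟩ := (hdet y).exists_glTrace_eq_one hp
    exact ⟨slSub x ht, (lie_slSub x ht hty).symm⟩
  let N' : LieSubmodule ℂ (Gl p) Y := submoduleOfOrbits horb N
  let f' : N' →ₗ[ℂ] M := (f : N →ₗ[ℂ] M)
  obtain ⟨ρ, hρ⟩ := exists_lieHom_of_surjective (L := Gl p) (N := N') f' hf (fun x n hn => by
    obtain ⟨h, hh⟩ := horb x n
    have h1 : f ⁅h, (⟨n.1, n.2⟩ : N)⁆ = 0 := by
      rw [LieModuleHom.map_lie]
      change ⁅h, f' n⁆ = 0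
      rw [hn, lie_zero]
    rw [← h1]
    exact congrArg f' (Subtype.ext hh))
  refine ⟨ρ, fun x m => ?_, r, k, N', { f' with map_lie' := fun {x n} => (hρ x n).symm }, hf⟩
  obtain ⟨n, rfl⟩ := hf m
  refine (hρ x n).trans (Eq.trans ?_ (f.map_lie x n))
  rfl

/-- A single t of trace one annihilates m under both structures. As x - tr(x) t lies in sl, the
value at x on m is forced. -/
theorem extension_unique (hp : IsCountablePairing p) {M : Type*} [AddCommGroup M] [Module ℂ M]
    [LieRingModule (Sl p) M] {ρ ρ' : Gl p →ₗ⁅ℂ⁆ Module.End ℂ M}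
    (h : ∀ (x : Sl p) (m : M), ρ x m = ⁅x, m⁆)
    (hρ : IsMixedTensorModule (Gl p) (Natl p) (Conatl p) (Res ρ M))
    (h' : ∀ (x : Sl p) (m : M), ρ' x m = ⁅x, m⁆)
    (hρ' : IsMixedTensorModule (Gl p) (Natl p) (Conatl p) (Res ρ' M)) : ρ = ρ' := by
  classical
  refine LieHom.ext fun x => LinearMap.ext fun m => ?_
  obtain ⟨S, T, h1⟩ := hρ.isDetermined m
  obtain ⟨S', T', h2⟩ := hρ'.isDetermined m
  obtain ⟨t, ht, hS, hT⟩ := exists_glTrace_eq_one hp (S ∪ S') (T ∪ T')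
  have e1 : ρ t m = 0 := h1 t (fun v hv => hS v (Finset.mem_union_left _ hv))
    fun w hw => hT w (Finset.mem_union_left _ hw)
  have e2 : ρ' t m = 0 := h2 t (fun v hv => hS v (Finset.mem_union_right _ hv))
    fun w hw => hT w (Finset.mem_union_right _ hw)
  have e3 : ρ (slSub x ht) m = ρ' (slSub x ht) m := (h _ m).trans (h' _ m).symm
  rw [coe_slSub] at e3
  simp only [map_sub, map_smul, LinearMap.sub_apply, LinearMap.smul_apply, e1, e2, smul_zero,
    sub_zero] at e3
  exact e3

end Extension

/-! ### Orthogonal and symplectic subalgebras -/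

section Swap

variable {V : Type*} [AddCommGroup V] [Module ℂ V]

/-- The map `v ⊗ w ↦ ε w ⊗ v`. -/
def glSwap (ω : V →ₗ[ℂ] V →ₗ[ℂ] ℂ) (ε : ℂ) : Gl ω →ₗ[ℂ] Gl ω :=
  (ε • (TensorProduct.comm ℂ V V).toLinearMap : V ⊗[ℂ] V →ₗ[ℂ] V ⊗[ℂ] V)

variable {ω : V →ₗ[ℂ] V →ₗ[ℂ] ℂ} {ε : ℂ}

theorem glSwap_tmul (v w : V) : glSwap ω ε (tmul ω v w) = ε • tmul ω w v := rfl

theorem glSwap_glMul (hε : ε * ε = 1) (hω : ∀ x y, ω x y = ε * ω y x) (a b : Gl ω) :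
    glSwap ω ε (glMul ω a b) = glMul ω (glSwap ω ε b) (glSwap ω ε a) := by
  induction a using gl_induction with
  | zero => simp
  | add a a' ha ha' => simp only [map_add, LinearMap.add_apply, ha, ha']
  | tmul v w =>
    induction b using gl_induction with
    | zero => simp
    | add b b' hb hb' => simp only [map_add, LinearMap.add_apply, hb, hb']
    | tmul v' w' =>
      rw [glMul_tmul, map_smul, glSwap_tmul, glSwap_tmul, glSwap_tmul, map_smul, map_smul,
        LinearMap.smul_apply, glMul_tmul, hω w v', smul_smul, smul_smul, smul_smul, ← mul_assoc,
        hε, one_mul, mul_comm]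

/-- Since minus the conatural action is adjoint to the natural one, `glSwap` is the passage to the
adjoint with respect to ω. -/
theorem natAct_glSwap (hω : ∀ x y, ω x y = ε * ω y x) (a : Gl ω) (x : V) :
    natAct₀ ω (glSwap ω ε a) x = -conatAct₀ ω a x := by
  have : (natAct₀ ω).flip x ∘ₗ glSwap ω ε = -(conatAct₀ ω).flip x :=
    TensorProduct.ext' fun v w => by
      change natAct₀ ω (ε • (w ⊗ₜ v)) x = -conatAct₀ ω (v ⊗ₜ w) x
      rw [map_smul, LinearMap.smul_apply, natAct₀_tmul, conatAct₀_tmul, neg_neg, smul_smul,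
        ← hω]
  exact LinearMap.congr_fun this a

/-- An element a negated by the swap equals half of a minus its swap, and all differences of this
kind lie in K by linearity. -/
theorem mem_iff_glSwap {K : LieSubalgebra ℂ (Gl ω)}
    (h₁ : ∀ v w, tmul ω v w - ε • tmul ω w v ∈ K) (h₂ : ∀ a ∈ K, glSwap ω ε a = -a) (a : Gl ω) :
    a ∈ K ↔ glSwap ω ε a = -a := by
  refine ⟨h₂ a, fun ha => ?_⟩
  have key : ∀ b : Gl ω, b - glSwap ω ε b ∈ K := by
    intro b
    induction b using gl_induction with
    | zero => rw [map_zero, sub_zero]; exact K.zero_mem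
    | add b c hb hc =>
      rw [map_add, add_sub_add_comm]
      exact K.add_mem hb hc
    | tmul v w => exact h₁ v w
  have h2 := K.smul_mem (2⁻¹ : ℂ) (key a)
  rw [ha, sub_neg_eq_add, ← two_smul ℂ a, smul_smul, inv_mul_cancel₀ two_ne_zero, one_smul] at h2
  exact h2

variable {V' W' : Type*} [AddCommGroup V'] [Module ℂ V'] [AddCommGroup W'] [Module ℂ W']
  {p' : V' →ₗ[ℂ] W' →ₗ[ℂ] ℂ}

/-- The swap negates the image of φ, hence exchanges α and β and negates α - β; so the extension
lands in K. The sign ε treats sp and so together. -/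
theorem exists_extension_to_swap_invariants (hp' : IsCountablePairing p')
    (hω : IsCountablePairing ω) (hε : ε * ε = 1) (hsymm : ∀ x y, ω x y = ε * ω y x)
    {K : LieSubalgebra ℂ (Gl ω)} (hK : ∀ a, a ∈ K ↔ glSwap ω ε a = -a)
    (φ : Sl p' →ₗ⁅ℂ⁆ K) (hφ : Function.Injective φ) :
    ∃ ψ : Gl p' →ₗ⁅ℂ⁆ K, Function.Injective ψ ∧ (∀ x : Sl p', ψ x = φ x) ∧
      IsGeneralTensorType ψ (Natl ω) (Natl ω) (Natl p') (Conatl p') ∧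
      ∀ (M : Type*) [AddCommGroup M] [Module ℂ M] [LieRingModule K M] [LieModule ℂ K M],
        IsPureTensorModule K (Natl ω) M → ∀ r : ℕ, socAlong φ M r = socAlong ψ M r := by
  classical
  obtain ⟨α, β, hs, hαβ, hσ⟩ := exists_split hp' hω.nondegenerate.2 (K.incl.comp φ)
  have hα : ∀ x, glSwap ω ε (α x) = β x :=
    hσ (glSwap ω ε) (glSwap_glMul hε hsymm) fun x => (hK _).1 (φ x).2
  have hβ : ∀ x, glSwap ω ε (β x) = α x := fun x => by
    rw [← hα]
    generalize α x = a
    induction a using gl_induction with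
    | zero => rw [map_zero, map_zero]
    | add b c hb hc => rw [map_add, map_add, hb, hc]
    | tmul v w => rw [glSwap_tmul, map_smul, glSwap_tmul, smul_smul, hε, one_smul]
  let ψ : Gl p' →ₗ⁅ℂ⁆ K :=
    { toFun := fun x => ⟨hs.lieHom x, (hK _).2 (by
        rw [hs.lieHom_apply, map_sub, hα, hβ, neg_sub])⟩
      map_add' := fun x y => Subtype.ext (map_add hs.lieHom x y)
      map_smul' := fun c x => Subtype.ext (map_smul hs.lieHom c x)
      map_lie' := fun {x y} => Subtype.ext (LieHom.map_lie hs.lieHom x y) }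
  have hext : ∀ x : Sl p', ψ x = φ x := fun x => Subtype.ext (hαβ x).symm
  have hinj := injective_of_injective_sl hp' hφ hext
  refine ⟨ψ, hinj, hext, ?_, fun M _ _ _ _ hM r => ?_⟩
  · obtain ⟨c, d, hcd⟩ := hp'.exists_eq_one
    -- β is the adjoint of α, so their ranks agree and k = l; this is what allows V to serve as its
    -- own conatural module.
    have hk : Module.finrank ℂ (LinearMap.range (natAct ω (β (tmul p' c d)))) =
        Module.finrank ℂ (LinearMap.range (natAct ω (α (tmul p' c d)))) := by
      have h1 : natAct₀ ω (β (tmul p' c d)) = -conatAct₀ ω (α (tmul p' c d)) :=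
        LinearMap.ext fun x => by rw [← hα]; exact natAct_glSwap hsymm _ x
      rw [finrank_range_natAct hω.nondegenerate (α _)]
      change Module.finrank ℂ (LinearMap.range (natAct₀ ω (β (tmul p' c d)))) =
        Module.finrank ℂ (LinearMap.range (conatAct₀ ω (α (tmul p' c d))))
      rw [h1, LinearMap.range_neg]
    have hts : HasTensorSocle (Gl p') (Res ψ (Natl ω)) (Natl p') (Conatl p')
        (Module.finrank ℂ (LinearMap.range (natAct ω (α (tmul p' c d)))))
        (Module.finrank ℂ (LinearMap.range (natAct ω (β (tmul p' c d))))) := IsSplitPair.hasTensorSocle (W := Res ψ (Natl ω)) hs.nat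
      (fun x w => LinearMap.congr_fun (map_sub (natAct ω) (α x) (β x)) w)
      hp'.nondegenerate hcd (finiteDimensional_range_natAct _) (finiteDimensional_range_natAct _)
      hω.rank_left.le
    have hpos := hs.finrank_pos hω.nondegenerate.2
      (fun x y hxy => hinj (Subtype.ext hxy)) hcd
    rw [hk] at hts hpos
    exact ⟨_, _, hpos, hts, hts⟩
  · refine socAlong_eq (fun x m => by rw [hext]) (fun m => ?_) r
    obtain ⟨S, T, h⟩ := hM.isDetermined (W := Natl ω) m
    -- Both finite sets consist of natural vectors here, so no condition on conatural vectors is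
    -- needed.
    obtain ⟨t, ht, h1, -⟩ := hs.exists_glTrace_eq_one hp' (S ∪ T) ∅
    exact ⟨t, ht, h _ (fun v hv => h1 v (Finset.mem_union_left _ hv))
      fun v hv => h1 v (Finset.mem_union_right _ hv)⟩

theorem mem_sp_iff (h : ∀ x y, ω x y = -ω y x) (a : Gl ω) :
    a ∈ Sp ω h ↔ glSwap ω (-1) a = -a := by
  refine mem_iff_glSwap (fun v w => ?_) (fun b hb => ?_) a
  · rw [neg_one_smul, sub_neg_eq_add]
    exact Submodule.subset_span ⟨v, w, rfl⟩
  · have hb' : b ∈ Submodule.span ℂ {a : Gl ω | ∃ v w : V, a = tmul ω v w + tmul ω w v} := hb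
    induction hb' using Submodule.span_induction with
    | zero => rw [map_zero, neg_zero]
    | add x y hx hy hx' hy' => rw [map_add, hx' hx, hy' hy, neg_add]
    | smul c x hx hx' => rw [map_smul, hx' hx, smul_neg]
    | mem x hx =>
      obtain ⟨v, w, rfl⟩ := hx
      rw [map_add, glSwap_tmul, glSwap_tmul]
      module

theorem mem_so_iff (h : ∀ x y, ω x y = ω y x) (a : Gl ω) :
    a ∈ So ω h ↔ glSwap ω 1 a = -a := by
  refine mem_iff_glSwap (fun v w => ?_) (fun b hb => ?_) a
  · rw [one_smul]
    exact Submodule.subset_span ⟨v, w, rfl⟩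
  · have hb' : b ∈ Submodule.span ℂ {a : Gl ω | ∃ v w : V, a = tmul ω v w - tmul ω w v} := hb
    induction hb' using Submodule.span_induction with
    | zero => rw [map_zero, neg_zero]
    | add x y hx hy hx' hy' => rw [map_add, hx' hx, hy' hy, neg_add]
    | smul c x hx hx' => rw [map_smul, hx' hx, smul_neg]
    | mem x hx =>
      obtain ⟨v, w, rfl⟩ := hx
      rw [map_sub, glSwap_tmul, glSwap_tmul]
      module

end Swap

end LocFin

/-! ### The four cases assembled. -/

theorem proposition3p3
    -- the algebra `sl(V', V'_*)`
    {V' : Type*} {Vs' : Type*} [AddCommGroup V'] [Module ℂ V'] [AddCommGroup Vs'] [Module ℂ Vs']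
    (p' : V' →ₗ[ℂ] Vs' →ₗ[ℂ] ℂ) (hp' : IsCountablePairing p')
    -- the spaces on which the algebra `𝔤` is built
    {V : Type*} {Vs : Type*} [AddCommGroup V] [Module ℂ V] [AddCommGroup Vs] [Module ℂ Vs] :
    -- (i) `𝔤 = sl(V, V_*)`
    (∀ p : V →ₗ[ℂ] Vs →ₗ[ℂ] ℂ, IsCountablePairing p →
      ∀ φ : Sl p' →ₗ⁅ℂ⁆ Sl p, Function.Injective φ →
      ∃ ψ : Gl p' →ₗ⁅ℂ⁆ Gl p, Function.Injective ψ ∧ (∀ x : Sl p', ψ x = φ x) ∧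
        IsGeneralTensorType ψ (Natl p) (Conatl p) (Natl p') (Conatl p') ∧
        ∀ (M : Type*) [AddCommGroup M] [Module ℂ M] [LieRingModule (Sl p) M]
          [LieModule ℂ (Sl p) M], IsMixedTensorModule (Sl p) (Natl p) (Conatl p) M →
          -- `M` is in a unique way a tensor `gl(V, V_*)`-module,
          (∃! ρ : Gl p →ₗ⁅ℂ⁆ Module.End ℂ M, (∀ (x : Sl p) (m : M), ρ x m = ⁅x, m⁆) ∧
            IsMixedTensorModule (Gl p) (Natl p) (Conatl p) (Res ρ M)) ∧
          -- and, considered as such, it has the same socle filtration over `gl(V', V'_*)`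
          ∀ ρ : Gl p →ₗ⁅ℂ⁆ Module.End ℂ M, (∀ (x : Sl p) (m : M), ρ x m = ⁅x, m⁆) →
            IsMixedTensorModule (Gl p) (Natl p) (Conatl p) (Res ρ M) →
            ∀ r : ℕ, socAlong φ M r = socAlong (ρ.comp ψ) M r) ∧
    -- (ii) `𝔤 = gl(V, V_*)`
    (∀ p : V →ₗ[ℂ] Vs →ₗ[ℂ] ℂ, IsCountablePairing p →
      ∀ φ : Sl p' →ₗ⁅ℂ⁆ Gl p, Function.Injective φ →
      ∃ ψ : Gl p' →ₗ⁅ℂ⁆ Gl p, Function.Injective ψ ∧ (∀ x : Sl p', ψ x = φ x) ∧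
        IsGeneralTensorType ψ (Natl p) (Conatl p) (Natl p') (Conatl p') ∧
        ∀ (M : Type*) [AddCommGroup M] [Module ℂ M] [LieRingModule (Gl p) M]
          [LieModule ℂ (Gl p) M], IsMixedTensorModule (Gl p) (Natl p) (Conatl p) M →
          ∀ r : ℕ, socAlong φ M r = socAlong ψ M r) ∧
    -- (ii) `𝔤 = sp(V)`, where `V_* = V`
    (∀ (p : V →ₗ[ℂ] V →ₗ[ℂ] ℂ) (h : ∀ x y, p x y = -p y x), IsCountablePairing p →
      ∀ φ : Sl p' →ₗ⁅ℂ⁆ Sp p h, Function.Injective φ →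
      ∃ ψ : Gl p' →ₗ⁅ℂ⁆ Sp p h, Function.Injective ψ ∧ (∀ x : Sl p', ψ x = φ x) ∧
        IsGeneralTensorType ψ (Natl p) (Natl p) (Natl p') (Conatl p') ∧
        ∀ (M : Type*) [AddCommGroup M] [Module ℂ M] [LieRingModule (Sp p h) M]
          [LieModule ℂ (Sp p h) M], IsPureTensorModule (Sp p h) (Natl p) M →
          ∀ r : ℕ, socAlong φ M r = socAlong ψ M r) ∧
    -- (ii) `𝔤 = so(V)`, where `V_* = V`
    (∀ (p : V →ₗ[ℂ] V →ₗ[ℂ] ℂ) (h : ∀ x y, p x y = p y x), IsCountablePairing p →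
      ∀ φ : Sl p' →ₗ⁅ℂ⁆ So p h, Function.Injective φ →
      ∃ ψ : Gl p' →ₗ⁅ℂ⁆ So p h, Function.Injective ψ ∧ (∀ x : Sl p', ψ x = φ x) ∧
        IsGeneralTensorType ψ (Natl p) (Natl p) (Natl p') (Conatl p') ∧
        ∀ (M : Type*) [AddCommGroup M] [Module ℂ M] [LieRingModule (So p h) M]
          [LieModule ℂ (So p h) M], IsPureTensorModule (So p h) (Natl p) M →
          ∀ r : ℕ, socAlong φ M r = socAlong ψ M r) := by
  refine ⟨fun p hp φ hφ => ?_, fun p hp φ hφ => ?_, fun p h hp φ hφ => ?_,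
    fun p h hp φ hφ => ?_⟩
  · obtain ⟨α, β, hs, hαβ, -⟩ := exists_split hp' hp.nondegenerate.2 ((Sl p).incl.comp φ)
    have hext : ∀ x : Sl p', hs.lieHom x = φ x := fun x => (hαβ x).symm
    have hinj : Function.Injective hs.lieHom :=
      injective_of_injective_sl hp' (φ := (Sl p).incl.comp φ)
        (fun x y hxy => hφ (Subtype.ext hxy)) hext
    refine ⟨hs.lieHom, hinj, hext, hs.isGeneralTensorType hp' hp hinj, fun M _ _ _ _ hM =>
      ⟨?_, fun ρ hρ hρM r => ?_⟩⟩
    · obtain ⟨ρ, hρ, hρM⟩ := exists_extension hp hM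
      exact ⟨ρ, ⟨hρ, hρM⟩, fun ρ' h' => extension_unique hp h'.1 h'.2 hρ hρM⟩
    · refine socAlong_eq (fun x m => ?_) (fun m => ?_) r
      · refine (hρ (φ x) m).symm.trans ?_
        rw [← hext]
        rfl
      · obtain ⟨S, T, h⟩ := hρM.isDetermined m
        obtain ⟨t, ht, h1, h2⟩ := hs.exists_glTrace_eq_one hp' S T
        exact ⟨t, ht, h _ h1 h2⟩
  · obtain ⟨α, β, hs, hαβ, -⟩ := exists_split hp' hp.nondegenerate.2 φ
    have hext : ∀ x : Sl p', hs.lieHom x = φ x := fun x => (hαβ x).symm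
    have hinj := injective_of_injective_sl hp' hφ hext
    refine ⟨hs.lieHom, hinj, hext, hs.isGeneralTensorType hp' hp hinj, fun M _ _ _ _ hM r => ?_⟩
    refine socAlong_eq (fun x m => by rw [hext]) (fun m => ?_) r
    obtain ⟨S, T, h⟩ := hM.isDetermined m
    obtain ⟨t, ht, h1, h2⟩ := hs.exists_glTrace_eq_one hp' S T
    exact ⟨t, ht, h _ h1 h2⟩
  · exact exists_extension_to_swap_invariants hp' hp (ε := -1) (by norm_num)
      (fun x y => by rw [h x y, neg_one_mul]) (mem_sp_iff h) φ hφ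
  · exact exists_extension_to_swap_invariants hp' hp (ε := 1) (by norm_num)
      (fun x y => by rw [h x y, one_mul]) (mem_so_iff h) φ hφ
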